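/- Let $(M,g)$ be a smooth four-dimensional Lorentzian manifold of signature $(-,+,+,+)$ with Levi-Civita connection $\nabla$. The curvature convention is $(\nabla_j\nabla_k-\nabla_k\nabla_j)\omega_l=R_{jkl}{}^m\omega_m$, with Ricci tensor $R_{km}=R^l{}_{klm}$, scalar curvature $R=R^k{}_k$ and Einstein tensor $G_{kl}=R_{kl}-\frac12 R\,g_{kl}$. Assume that $(M,g)$ is static, i.e. there is a smooth vector field $u$ such that, with the acceleration $\dot u_k=u^j\nabla_j u_k$, $$u_ju^j=-1,\qquad \nabla_i u_j=-u_i\dot u_j,\qquad \nabla_i\dot u_j=\nabla_j\dot u_i .$$ Let $\tau$ be a smooth function on $M$ with $\nabla_j\tau=\dot u_j$, and put $\xi=e^{\tau}u$ and $\eta=\dot u^k\dot u_k$. Define the Altas–Tekin tensor $$\Phi_{kl}=g_{kl}\Big(\tfrac12 G_{pq}G^{pq}-\tfrac16R^2+\tfrac12\nabla^2R\Big)+4R_{jklm}G^{mj}+2G_{km}G_l{}^m+\tfrac43 R\,G_{kl}.$$ Then $\xi$ is a Killing vector field. Through every point of $M$ there passes a space submanifold (an immersed hypersurface orthogonal to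 $u$), and the scalar curvature at a point of its induced metric is the same for every space submanifold through that point; it defines a function $R^\star$ on $M$. The Altas–Tekin current $\Phi_{kl}\xi^l$ is proportional to $\xi$: at every point of $M$, in all local coordinates, $$\Phi_{kl}\,\xi^l=\varphi\,\xi_k,$$ $$\varphi=\tfrac12G_{pq}G^{pq}-\tfrac16R^2+\tfrac12\nabla^2R+\tfrac12R^{\star2}-\tfrac23RR^\star+2R^\star\eta+4G^{jm}\big(\dot u_j\dot u_m+\nabla_j\dot u_m\big).$$ -/

import Mathlib

open scoped Manifold ContDiff

noncomputable section

namespace StaticCKG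

/-- Coordinate space of dimension `n`. -/
abbrev E (n : ℕ) : Type := EuclideanSpace ℝ (Fin n)

/-! ### Tensor calculus in coordinates

A (pseudo-Riemannian) metric in coordinates is a matrix-valued function `γ` on `E n`, with
`γ x i j` the component `γ_{ij}(x)`. Covectors, bilinear forms, … are given by their components. -/

/-- The partial derivative `∂_i f` at `x`. -/
def pd {n : ℕ} (i : Fin n) (f : E n → ℝ) (x : E n) : ℝ :=
  fderiv ℝ f x (EuclideanSpace.single i 1)

/-- Christoffel symbols of the Levi-Civita connection, `Γ^k_{ij}`. -/
def christoffel {n : ℕ} (γ : E n → Matrix (Fin n) (Fin n) ℝ) (x : E n) (k i j : Fin n) : ℝ :=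
  (1 / 2) * ∑ l, (γ x)⁻¹ k l *
    (pd i (fun y => γ y j l) x + pd j (fun y => γ y i l) x - pd l (fun y => γ y i j) x)

/-- The covariant derivative `∇_i α_j` of a covector field. -/
def covDeriv {n : ℕ} (γ : E n → Matrix (Fin n) (Fin n) ℝ) (α : E n → Fin n → ℝ)
    (x : E n) (i j : Fin n) : ℝ :=
  pd i (fun y => α y j) x - ∑ k, christoffel γ x k i j * α x k

/-- The Laplacian (wave operator) `∇²f = γ^{ij} ∇_i ∇_j f` of a scalar field. -/
def laplacian {n : ℕ} (γ : E n → Matrix (Fin n) (Fin n) ℝ) (f : E n → ℝ) (x : E n) : ℝ :=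
  ∑ i, ∑ j, (γ x)⁻¹ i j * covDeriv γ (fun y k => pd k f y) x i j

/-- The curvature `R^p_{klm} = ∂_l Γ^p_{mk} - ∂_m Γ^p_{lk} + Γ^p_{lq} Γ^q_{mk} - Γ^p_{mq} Γ^q_{lk}`. -/
def riemannUp {n : ℕ} (γ : E n → Matrix (Fin n) (Fin n) ℝ) (x : E n) (p k l m : Fin n) : ℝ :=
  pd l (fun y => christoffel γ y p m k) x - pd m (fun y => christoffel γ y p l k) x
    + ∑ q, (christoffel γ x p l q * christoffel γ x q m k
        - christoffel γ x p m q * christoffel γ x q l k)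

/-- The Riemann tensor `R_{jklm} = γ_{jp} R^p_{klm}`; with this sign
`(∇_j ∇_k - ∇_k ∇_j) α_l = R_{jkl}{}^m α_m`. -/
def riemann {n : ℕ} (γ : E n → Matrix (Fin n) (Fin n) ℝ) (x : E n) (j k l m : Fin n) : ℝ :=
  ∑ p, γ x j p * riemannUp γ x p k l m

/-- The Ricci tensor `R_{km} = R^l_{klm}`. -/
def ricci {n : ℕ} (γ : E n → Matrix (Fin n) (Fin n) ℝ) (x : E n) (k m : Fin n) : ℝ :=
  ∑ l, riemannUp γ x l k l m

/-- The scalar curvature `R = γ^{kl} R_{kl}`. -/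
def scalarCurv {n : ℕ} (γ : E n → Matrix (Fin n) (Fin n) ℝ) (x : E n) : ℝ :=
  ∑ k, ∑ l, (γ x)⁻¹ k l * ricci γ x k l

/-- The Einstein tensor `G_{kl} = R_{kl} - ½ R γ_{kl}`. -/
def einstein {n : ℕ} (γ : E n → Matrix (Fin n) (Fin n) ℝ) (x : E n) (k l : Fin n) : ℝ :=
  ricci γ x k l - (1 / 2) * scalarCurv γ x * γ x k l

/-- The Einstein tensor with both indices raised, `G^{kl}`. -/
def einsteinUp {n : ℕ} (γ : E n → Matrix (Fin n) (Fin n) ℝ) (x : E n) (k l : Fin n) : ℝ :=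
  ∑ p, ∑ q, (γ x)⁻¹ k p * (γ x)⁻¹ l q * einstein γ x p q

/-- The scalar `G_{pq} G^{pq}`. -/
def einsteinSq {n : ℕ} (γ : E n → Matrix (Fin n) (Fin n) ℝ) (x : E n) : ℝ :=
  ∑ p, ∑ q, einstein γ x p q * einsteinUp γ x p q

/-- The Altas–Tekin tensor
`Φ_{kl} = γ_{kl} (½ G_{pq}G^{pq} - R²/6 + ½ ∇²R) + 4 R_{jklm} G^{mj} + 2 G_{km} G_l{}^m + (4/3) R G_{kl}`. -/
def altasTekin {n : ℕ} (γ : E n → Matrix (Fin n) (Fin n) ℝ) (x : E n) (k l : Fin n) : ℝ :=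
  γ x k l * ((1 / 2) * einsteinSq γ x - (1 / 6) * scalarCurv γ x ^ 2
      + (1 / 2) * laplacian γ (scalarCurv γ) x)
    + 4 * ∑ j, ∑ m, riemann γ x j k l m * einsteinUp γ x m j
    + 2 * ∑ m, ∑ p, (γ x)⁻¹ m p * einstein γ x k m * einstein γ x l p
    + (4 / 3) * scalarCurv γ x * einstein γ x k l

/-- Lowering the index of a vector field, `v_k = γ_{kl} v^l`. -/
def lower {n : ℕ} (γ : E n → Matrix (Fin n) (Fin n) ℝ) (v : E n → Fin n → ℝ)
    (x : E n) (k : Fin n) : ℝ :=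
  ∑ l, γ x k l * v x l

/-- The acceleration `u̇_k = u^j ∇_j u_k` of a vector field `u^j`. -/
def accel {n : ℕ} (γ : E n → Matrix (Fin n) (Fin n) ℝ) (u : E n → Fin n → ℝ)
    (x : E n) (k : Fin n) : ℝ :=
  ∑ j, u x j * covDeriv γ (lower γ u) x j k

/-- The scalar `η = u̇^k u̇_k`. -/
def etaScalar {n : ℕ} (γ : E n → Matrix (Fin n) (Fin n) ℝ) (u : E n → Fin n → ℝ) (x : E n) : ℝ :=
  ∑ k, ∑ l, (γ x)⁻¹ k l * accel γ u x k * accel γ u x l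

/-- The scalar
`φ = ½ G_{pq}G^{pq} - R²/6 + ½ ∇²R + ½ r² - (2/3) R r + 2 r η + 4 G^{jm} (u̇_j u̇_m + ∇_j u̇_m)`,
where `r` is the value of the spatial scalar curvature at `x`. -/
def phiScalar {n : ℕ} (γ : E n → Matrix (Fin n) (Fin n) ℝ) (u : E n → Fin n → ℝ)
    (r : ℝ) (x : E n) : ℝ :=
  (1 / 2) * einsteinSq γ x - (1 / 6) * scalarCurv γ x ^ 2
    + (1 / 2) * laplacian γ (scalarCurv γ) x
    + (1 / 2) * r ^ 2 - (2 / 3) * scalarCurv γ x * r + 2 * r * etaScalar γ u x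
    + 4 * ∑ j, ∑ m, einsteinUp γ x j m *
        (accel γ u x j * accel γ u x m + covDeriv γ (accel γ u) x j m)

/-! ### Four-dimensional spacetimes -/

section Spacetime

variable {M : Type*} [TopologicalSpace M] [ChartedSpace (E 4) M]

/-- The components `B(∂_i f, ∂_j f)` of the pull-back of a field `B` of bilinear forms along a map
`f` from a coordinate space. For `f` the inverse of a chart these are the components of `B` in the
chart; for `f` a parametrized submanifold they are the components of the induced form. -/
def pullbackForm {n : ℕ}
    (B : ∀ p : M, LinearMap.BilinForm ℝ (TangentSpace 𝓘(ℝ, E 4) p))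
    (f : E n → M) (x : E n) : Matrix (Fin n) (Fin n) ℝ :=
  Matrix.of fun i j => B (f x)
    (mfderiv 𝓘(ℝ, E n) 𝓘(ℝ, E 4) f x (EuclideanSpace.single i (1 : ℝ) : E n))
    (mfderiv 𝓘(ℝ, E n) 𝓘(ℝ, E 4) f x (EuclideanSpace.single j (1 : ℝ) : E n))

/-- The components `v^i` of a vector field in the chart `e`. -/
def vecComp (v : ∀ p : M, TangentSpace 𝓘(ℝ, E 4) p) (e : OpenPartialHomeomorph M (E 4))
    (x : E 4) (i : Fin 4) : ℝ :=
  (show E 4 from mfderiv 𝓘(ℝ, E 4) 𝓘(ℝ, E 4) e (e.symm x) (v (e.symm x))) i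

variable (M) in
/-- The smooth coordinate charts of `M`. -/
abbrev Charts : Set (OpenPartialHomeomorph M (E 4)) :=
  IsManifold.maximalAtlas 𝓘(ℝ, E 4) ∞ M

/-- A smooth vector field: its components in every smooth chart are smooth. -/
def IsSmoothVectorField (v : ∀ p : M, TangentSpace 𝓘(ℝ, E 4) p) : Prop :=
  ∀ e ∈ Charts M, ∀ i, ContDiffOn ℝ ∞ (fun x => vecComp v e x i) e.target

variable (M) in
/-- A smooth Lorentzian metric of signature `(-,+,+,+)` on `M`. -/
structure LorentzMetric where
  /-- The scalar product on each tangent space. -/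
  form : ∀ p : M, LinearMap.BilinForm ℝ (TangentSpace 𝓘(ℝ, E 4) p)
  symm : ∀ (p : M) (v w : TangentSpace 𝓘(ℝ, E 4) p), form p v w = form p w v
  /-- Every tangent space has a Lorentz-orthonormal basis. -/
  signature : ∀ p : M, ∃ b : Module.Basis (Fin 4) ℝ (TangentSpace 𝓘(ℝ, E 4) p),
    ∀ i j, form p (b i) (b j) = Matrix.diagonal ![(-1 : ℝ), 1, 1, 1] i j
  smooth : ∀ e ∈ Charts M, ∀ i j,
    ContDiffOn ℝ ∞ (fun x => pullbackForm form e.symm x i j) e.target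

/-- The components `g_{ij}` of the metric in the chart `e`. -/
def LorentzMetric.inChart (g : LorentzMetric M) (e : OpenPartialHomeomorph M (E 4)) :
    E 4 → Matrix (Fin 4) (Fin 4) ℝ :=
  pullbackForm g.form e.symm

/-- `(M, g)` is static with velocity field `u`: `u_j u^j = -1`, `∇_i u_j = - u_i u̇_j` and
`∇_i u̇_j = ∇_j u̇_i`. -/
structure IsStatic (g : LorentzMetric M) (u : ∀ p : M, TangentSpace 𝓘(ℝ, E 4) p) : Prop where
  smooth : IsSmoothVectorField u
  unit : ∀ p, g.form p (u p) (u p) = -1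
  covDeriv_velocity : ∀ e ∈ Charts M, ∀ x ∈ e.target, ∀ i j,
    covDeriv (g.inChart e) (lower (g.inChart e) (vecComp u e)) x i j
      = - lower (g.inChart e) (vecComp u e) x i * accel (g.inChart e) (vecComp u e) x j
  covDeriv_accel : ∀ e ∈ Charts M, ∀ x ∈ e.target, ∀ i j,
    covDeriv (g.inChart e) (accel (g.inChart e) (vecComp u e)) x i j
      = covDeriv (g.inChart e) (accel (g.inChart e) (vecComp u e)) x j i

/-- `τ` is a smooth potential of the acceleration of `u`: `u̇_j = ∇_j τ`. -/
structure IsAccelPotential (g : LorentzMetric M) (u : ∀ p : M, TangentSpace 𝓘(ℝ, E 4) p)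
    (τ : M → ℝ) : Prop where
  smooth : ContMDiff 𝓘(ℝ, E 4) 𝓘(ℝ, ℝ) ∞ τ
  grad : ∀ e ∈ Charts M, ∀ x ∈ e.target, ∀ j,
    accel (g.inChart e) (vecComp u e) x j = pd j (fun y => τ (e.symm y)) x

/-- The vector field `ξ = e^τ u`. -/
def staticKilling (u : ∀ p : M, TangentSpace 𝓘(ℝ, E 4) p) (τ : M → ℝ) (p : M) :
    TangentSpace 𝓘(ℝ, E 4) p :=
  Real.exp (τ p) • u p

/-- `v` is a Killing vector field: `∇_i v_j + ∇_j v_i = 0`. -/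
def IsKilling (g : LorentzMetric M) (v : ∀ p : M, TangentSpace 𝓘(ℝ, E 4) p) : Prop :=
  IsSmoothVectorField v ∧ ∀ e ∈ Charts M, ∀ x ∈ e.target, ∀ i j,
    covDeriv (g.inChart e) (lower (g.inChart e) (vecComp v e)) x i j
      + covDeriv (g.inChart e) (lower (g.inChart e) (vecComp v e)) x j i = 0

/-- A (parametrized piece of a) space submanifold: a smooth immersed hypersurface that is everywhere
orthogonal to the velocity `u`. -/
structure SpatialSlice (g : LorentzMetric M) (u : ∀ p : M, TangentSpace 𝓘(ℝ, E 4) p) where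
  /-- The parameter domain. -/
  domain : Set (E 3)
  /-- The parametrization. -/
  map : E 3 → M
  isOpen_domain : IsOpen domain
  smooth : ContMDiffOn 𝓘(ℝ, E 3) 𝓘(ℝ, E 4) ∞ map domain
  immersion : ∀ y ∈ domain, Function.Injective (mfderiv 𝓘(ℝ, E 3) 𝓘(ℝ, E 4) map y)
  orthogonal : ∀ y ∈ domain, ∀ v : TangentSpace 𝓘(ℝ, E 3) y,
    g.form (map y) (u (map y)) (mfderiv 𝓘(ℝ, E 3) 𝓘(ℝ, E 4) map y v) = 0

/-- The induced metric of a space submanifold, in its parameters. -/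
def SpatialSlice.metric {g : LorentzMetric M} {u : ∀ p : M, TangentSpace 𝓘(ℝ, E 4) p}
    (S : SpatialSlice g u) : E 3 → Matrix (Fin 3) (Fin 3) ℝ :=
  pullbackForm g.form S.map

/-- `r` is the scalar curvature `R⋆` of the space submanifolds: every point lies on a space
submanifold, and along each of them `r` is the scalar curvature of its induced metric.
These two properties determine `r`. -/
structure IsSpatialScalarCurv (g : LorentzMetric M) (u : ∀ p : M, TangentSpace 𝓘(ℝ, E 4) p)
    (r : M → ℝ) : Prop where
  exists_slice : ∀ p : M, ∃ S : SpatialSlice g u, ∃ y ∈ S.domain, S.map y = p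
  eq_scalarCurv : ∀ (S : SpatialSlice g u), ∀ y ∈ S.domain, r (S.map y) = scalarCurv S.metric y

end Spacetime

end StaticCKG

end

/-! Write a for the acceleration, A = a ⊗ a + ∇a for the tidal tensor (`tidal`) and s = 2 G(u,u)
(`spatialScalar`). The static condition ∇_i u_j = -u_i a_j is a first-order equation for u; its
integrability condition, the Ricci identity, reads R_{jklm} u^j = u_m A_{lk} - u_l A_{mk}
(`lower_vecMul_curv`, `sum_vel_riemann`). Differentiating u·u = -1 and then a·u = 0 gives A u = η u
(`tidal_mulVec`). Hence every contraction of the curvature with u is explicit: u is an eigenvector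
of the Ricci and Einstein tensors, G u = -(s/2) u, and R_{jklm} G^{mj} u^l = (G·A + sη/2) u_k.
Inserted in Φ, this yields the formula for φ with s in place of R⋆ (`altasTekin_vel`).

It remains to identify s with R⋆. The second fundamental form of a hypersurface orthogonal to u is,
up to sign, the tangential part of ∇u = -u ⊗ a, which vanishes. The hypersurface is therefore
totally geodesic (`pdM_jac`), and its curvature is the restriction of the ambient one
(`pullCurv_mul_jac`). Tracing with g⁻¹ + u ⊗ u gives R + 2 Ric(u,u) = 2 G(u,u) (`scalarCurv_eq`).

Such hypersurfaces exist because the one-form e^{-τ} u is closed: it is locally df, and the level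
sets of f are orthogonal to u (`exists_spatialSlice`). The Killing equation holds because ∇_i ξ_j =
e^τ (a_i u_j - u_i a_j) is antisymmetric. -/

namespace StaticCKG

open Matrix Filter Topology

/-! ### Partial derivatives -/

section Calculus

variable {n : ℕ} {ι κ μ : Type*}

theorem pd_congr {f g : E n → ℝ} {x : E n} (i : Fin n) (h : f =ᶠ[𝓝 x] g) : pd i f x = pd i g x := by
  simp only [pd, h.fderiv_eq]

theorem pd_const (i : Fin n) (c : ℝ) (x : E n) : pd i (fun _ => c) x = 0 := by
  simp [pd]

theorem pd_add {f g : E n → ℝ} {x : E n} (i : Fin n) (hf : DifferentiableAt ℝ f x)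
    (hg : DifferentiableAt ℝ g x) : pd i (fun y => f y + g y) x = pd i f x + pd i g x := by
  simp [pd, fderiv_fun_add hf hg]

theorem pd_sub {f g : E n → ℝ} {x : E n} (i : Fin n) (hf : DifferentiableAt ℝ f x)
    (hg : DifferentiableAt ℝ g x) : pd i (fun y => f y - g y) x = pd i f x - pd i g x := by
  simp [pd, fderiv_fun_sub hf hg]

theorem pd_neg {f : E n → ℝ} {x : E n} (i : Fin n) :
    pd i (fun y => -f y) x = -pd i f x := by
  simp [pd, fderiv_fun_neg]

theorem pd_mul {f g : E n → ℝ} {x : E n} (i : Fin n) (hf : DifferentiableAt ℝ f x)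
    (hg : DifferentiableAt ℝ g x) :
    pd i (fun y => f y * g y) x = pd i f x * g x + f x * pd i g x := by
  simp [pd, fderiv_fun_mul hf hg]
  ring

theorem pd_sum {s : Finset ι} {f : ι → E n → ℝ} {x : E n} (i : Fin n)
    (hf : ∀ k ∈ s, DifferentiableAt ℝ (f k) x) :
    pd i (fun y => ∑ k ∈ s, f k y) x = ∑ k ∈ s, pd i (f k) x := by
  simp [pd, fderiv_fun_sum hf]

theorem euclidean_eq_sum_single (v : E n) :
    v = ∑ i, v i • (EuclideanSpace.single i 1 : E n) := by
  ext j
  simp [Finset.sum_apply, Pi.single_apply]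

theorem fderiv_eq_sum_pd (f : E n → ℝ) (x v : E n) : fderiv ℝ f x v = ∑ i, v i * pd i f x := by
  conv_lhs => rw [euclidean_eq_sum_single v]
  simp [pd]

/-- The chain rule for partial derivatives. -/
theorem pd_comp {m : ℕ} {f : E n → ℝ} {φ : E m → E n} {y : E m} (a : Fin m)
    (hf : DifferentiableAt ℝ f (φ y)) (hφ : DifferentiableAt ℝ φ y) :
    pd a (fun z => f (φ z)) y = ∑ i, pd a (fun z => φ z i) y * pd i f (φ y) := by
  have h1 : pd a (fun z => f (φ z)) y
      = fderiv ℝ f (φ y) (fderiv ℝ φ y (EuclideanSpace.single a 1)) := by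
    have := fderiv_comp y hf hφ
    simp only [pd]
    exact congrArg (fun L => L (EuclideanSpace.single a 1)) this
  rw [h1, fderiv_eq_sum_pd]
  refine Finset.sum_congr rfl fun i _ => ?_
  congr 1
  have h2 : HasFDerivAt (fun z => φ z i)
      ((EuclideanSpace.proj i : E n →L[ℝ] ℝ).comp (fderiv ℝ φ y)) y :=
    (EuclideanSpace.proj i : E n →L[ℝ] ℝ).hasFDerivAt.comp y hφ.hasFDerivAt
  simp [pd, h2.fderiv]

theorem contDiffAt_pd {f : E n → ℝ} {x : E n} (hf : ContDiffAt ℝ ∞ f x) (i : Fin n) :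
    ContDiffAt ℝ ∞ (pd i f) x :=
  (hf.fderiv_right (m := ∞) le_rfl).clm_apply contDiffAt_const

theorem differentiableAt_of_smooth {F : Type*} [NormedAddCommGroup F] [NormedSpace ℝ F]
    {f : E n → F} {x : E n} (hf : ContDiffAt ℝ ∞ f x) : DifferentiableAt ℝ f x :=
  hf.differentiableAt (by simp)

/-- Partial derivatives commute. -/
theorem pd_comm {f : E n → ℝ} {x : E n} (hf : ContDiffAt ℝ ∞ f x) (i j : Fin n) :
    pd i (pd j f) x = pd j (pd i f) x := by
  have hd : DifferentiableAt ℝ (fderiv ℝ f) x :=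
    differentiableAt_of_smooth (hf.fderiv_right (m := ∞) le_rfl)
  have key : ∀ k l : Fin n, pd k (pd l f) x
      = fderiv ℝ (fderiv ℝ f) x (EuclideanSpace.single k 1) (EuclideanSpace.single l 1) := by
    intro k l
    have : HasFDerivAt (pd l f) _ x :=
      hd.hasFDerivAt.clm_apply (hasFDerivAt_const (EuclideanSpace.single l (1 : ℝ) : E n) x)
    conv_lhs => rw [pd, this.fderiv]
    simp
  rw [key, key]
  exact (hf.isSymmSndFDerivAt (by simpa using (WithTop.coe_le_coe.2 (le_top : (2 : ℕ∞) ≤ ⊤)))).eq _ _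

/-! ### Matrix- and vector-valued functions -/

/-- The entrywise partial derivative of a matrix-valued function. -/
noncomputable def pdM (a : Fin n) (M : E n → Matrix ι κ ℝ) (x : E n) : Matrix ι κ ℝ :=
  Matrix.of fun i j => pd a (fun y => M y i j) x

/-- The componentwise partial derivative of a vector-valued function. -/
noncomputable def pdV (a : Fin n) (v : E n → ι → ℝ) (x : E n) : ι → ℝ := fun i => pd a (fun y => v y i) x

/-- Entrywise smoothness of a matrix-valued function at a point. -/
def SmoothM (M : E n → Matrix ι κ ℝ) (x : E n) : Prop :=
  ∀ i j, ContDiffAt ℝ ∞ (fun y => M y i j) x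

/-- Componentwise smoothness of a vector-valued function at a point. -/
def SmoothV (v : E n → ι → ℝ) (x : E n) : Prop := ∀ i, ContDiffAt ℝ ∞ (fun y => v y i) x

theorem pdM_congr {M N : E n → Matrix ι κ ℝ} {x : E n} (a : Fin n) (h : M =ᶠ[𝓝 x] N) :
    pdM a M x = pdM a N x := by
  ext i j
  exact pd_congr a (h.mono fun y hy => by simp only [hy])

theorem pdV_congr {v w : E n → ι → ℝ} {x : E n} (a : Fin n) (h : v =ᶠ[𝓝 x] w) :
    pdV a v x = pdV a w x := by
  ext i
  exact pd_congr a (h.mono fun y hy => by simp only [hy])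

theorem pdM_sub {M N : E n → Matrix ι κ ℝ} {x : E n} (a : Fin n) (hM : SmoothM M x)
    (hN : SmoothM N x) : pdM a (fun y => M y - N y) x = pdM a M x - pdM a N x := by
  ext i j
  exact pd_sub a (differentiableAt_of_smooth (hM i j)) (differentiableAt_of_smooth (hN i j))

theorem pdM_transpose (M : E n → Matrix ι κ ℝ) (x : E n) (a : Fin n) :
    pdM a (fun y => (M y)ᵀ) x = (pdM a M x)ᵀ := rfl

theorem pdM_mul [Fintype κ] {M : E n → Matrix ι κ ℝ} {N : E n → Matrix κ μ ℝ} {x : E n}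
    (a : Fin n) (hM : SmoothM M x) (hN : SmoothM N x) :
    pdM a (fun y => M y * N y) x = pdM a M x * N x + M x * pdM a N x := by
  ext i j
  simp only [pdM, Matrix.of_apply, Matrix.mul_apply, Matrix.add_apply]
  rw [pd_sum a fun k _ => (differentiableAt_of_smooth (hM i k)).fun_mul
    (differentiableAt_of_smooth (hN k j)), ← Finset.sum_add_distrib]
  exact Finset.sum_congr rfl fun k _ => pd_mul a (differentiableAt_of_smooth (hM i k))
    (differentiableAt_of_smooth (hN k j))

theorem pdV_sub {v w : E n → ι → ℝ} {x : E n} (a : Fin n) (hv : SmoothV v x)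
    (hw : SmoothV w x) : pdV a (fun y => v y - w y) x = pdV a v x - pdV a w x := by
  ext i
  exact pd_sub a (differentiableAt_of_smooth (hv i)) (differentiableAt_of_smooth (hw i))

theorem pdV_smul {f : E n → ℝ} {v : E n → ι → ℝ} {x : E n} (a : Fin n)
    (hf : ContDiffAt ℝ ∞ f x) (hv : SmoothV v x) :
    pdV a (fun y => f y • v y) x = pd a f x • v x + f x • pdV a v x := by
  ext i
  exact pd_mul a (differentiableAt_of_smooth hf) (differentiableAt_of_smooth (hv i))

theorem pdV_vecMul [Fintype κ] {v : E n → κ → ℝ} {N : E n → Matrix κ μ ℝ} {x : E n}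
    (a : Fin n) (hv : SmoothV v x) (hN : SmoothM N x) :
    pdV a (fun y => v y ᵥ* N y) x = pdV a v x ᵥ* N x + v x ᵥ* pdM a N x := by
  ext j
  simp only [pdM, pdV, Matrix.of_apply, Matrix.vecMul, dotProduct, Pi.add_apply]
  rw [pd_sum a fun k _ => (differentiableAt_of_smooth (hv k)).fun_mul
    (differentiableAt_of_smooth (hN k j)), ← Finset.sum_add_distrib]
  exact Finset.sum_congr rfl fun k _ => pd_mul a (differentiableAt_of_smooth (hv k))
    (differentiableAt_of_smooth (hN k j))

theorem pd_dotProduct [Fintype κ] {v w : E n → κ → ℝ} {x : E n}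
    (a : Fin n) (hv : SmoothV v x) (hw : SmoothV w x) :
    pd a (fun y => v y ⬝ᵥ w y) x = pdV a v x ⬝ᵥ w x + v x ⬝ᵥ pdV a w x := by
  simp only [pdV, dotProduct]
  rw [pd_sum a fun k _ => (differentiableAt_of_smooth (hv k)).fun_mul
    (differentiableAt_of_smooth (hw k)), ← Finset.sum_add_distrib]
  exact Finset.sum_congr rfl fun k _ => pd_mul a (differentiableAt_of_smooth (hv k))
    (differentiableAt_of_smooth (hw k))

theorem SmoothM.mul [Fintype κ] {M : E n → Matrix ι κ ℝ} {N : E n → Matrix κ μ ℝ} {x : E n}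
    (hM : SmoothM M x) (hN : SmoothM N x) : SmoothM (fun y => M y * N y) x := by
  intro i j
  simp only [Matrix.mul_apply]
  exact ContDiffAt.sum fun k _ => (hM i k).mul (hN k j)

theorem SmoothM.transpose {M : E n → Matrix ι κ ℝ} {x : E n}
    (hM : SmoothM M x) : SmoothM (fun y => (M y)ᵀ) x :=
  fun i j => hM j i

theorem pdM_comm {M : E n → Matrix ι κ ℝ} {x : E n} (hM : SmoothM M x) (a b : Fin n) :
    pdM a (pdM b M) x = pdM b (pdM a M) x := by
  ext i j
  exact pd_comm (hM i j) a b

theorem pdV_comm {v : E n → ι → ℝ} {x : E n} (hv : SmoothV v x) (a b : Fin n) :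
    pdV a (pdV b v) x = pdV b (pdV a v) x := by
  ext i
  exact pd_comm (hv i) a b

theorem SmoothV.pdV {v : E n → ι → ℝ} {x : E n} (hv : SmoothV v x) (a : Fin n) :
    SmoothV (pdV a v) x :=
  fun i => contDiffAt_pd (hv i) a

theorem SmoothV.vecMul [Fintype κ] {v : E n → κ → ℝ} {N : E n → Matrix κ μ ℝ} {x : E n}
    (hv : SmoothV v x) (hN : SmoothM N x) : SmoothV (fun y => v y ᵥ* N y) x := by
  intro j
  simp only [Matrix.vecMul, dotProduct]
  exact ContDiffAt.sum fun k _ => (hv k).mul (hN k j)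

theorem SmoothV.smul {f : E n → ℝ} {v : E n → ι → ℝ} {x : E n}
    (hf : ContDiffAt ℝ ∞ f x) (hv : SmoothV v x) : SmoothV (fun y => f y • v y) x :=
  fun i => hf.mul (hv i)

theorem SmoothM.det [Fintype ι] [DecidableEq ι] {M : E n → Matrix ι ι ℝ} {x : E n}
    (hM : SmoothM M x) : ContDiffAt ℝ ∞ (fun y => (M y).det) x := by
  simp only [Matrix.det_apply]
  exact ContDiffAt.sum fun σ _ => (contDiffAt_prod fun i _ => hM (σ i) i).const_smul _

/-- Cramer's rule: an entry of the inverse is a determinant with one row replaced by a constant one,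
divided by the full determinant. -/
theorem SmoothM.inv [Fintype ι] [DecidableEq ι] {M : E n → Matrix ι ι ℝ} {x : E n}
    (hM : SmoothM M x) (hdet : (M x).det ≠ 0) : SmoothM (fun y => (M y)⁻¹) x := by
  intro i j
  simp only [Matrix.inv_def, Matrix.smul_apply, smul_eq_mul, Ring.inverse_eq_inv',
    Matrix.adjugate_apply]
  refine (hM.det.inv hdet).mul (SmoothM.det fun k l => ?_)
  simp only [Matrix.updateRow_apply]
  split_ifs
  · exact contDiffAt_const
  · exact hM k l

end Calculus

end StaticCKG

namespace StaticCKG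

open Matrix Filter Topology

/-! ### The Levi-Civita connection and its curvature as matrices -/

section LeviCivita

variable {n : ℕ}

/-- `γ` is a smooth nondegenerate metric on the open set `U` of a coordinate space. -/
structure IsMetricOn (γ : E n → Matrix (Fin n) (Fin n) ℝ) (U : Set (E n)) : Prop where
  isOpen : IsOpen U
  smooth : ∀ x ∈ U, SmoothM γ x
  symm : ∀ x ∈ U, (γ x).IsSymm
  det_ne_zero : ∀ x ∈ U, (γ x).det ≠ 0

/-- The connection matrices `(Γ_i)^k_j = Γ^k_{ij}`. -/
noncomputable def conn (γ : E n → Matrix (Fin n) (Fin n) ℝ) (i : Fin n) (x : E n) :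
    Matrix (Fin n) (Fin n) ℝ :=
  Matrix.of fun k j => christoffel γ x k i j

/-- The curvature matrices `(R_{lm})^p_k = R^p_{klm}`. -/
noncomputable def curv (γ : E n → Matrix (Fin n) (Fin n) ℝ) (l m : Fin n) (x : E n) :
    Matrix (Fin n) (Fin n) ℝ :=
  pdM l (conn γ m) x - pdM m (conn γ l) x + (conn γ l x * conn γ m x - conn γ m x * conn γ l x)

variable {γ : E n → Matrix (Fin n) (Fin n) ℝ} {U : Set (E n)} {x : E n}

/-- The curvature is the endomorphism-valued two-form dΓ + Γ ∧ Γ. In this form the Ricci identity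
and the Gauss equation become noncommutative matrix algebra. -/
theorem riemannUp_eq_curv (x : E n) (p k l m : Fin n) :
    riemannUp γ x p k l m = curv γ l m x p k := by
  simp [riemannUp, curv, conn, pdM, Matrix.mul_apply, Finset.sum_sub_distrib]

theorem riemann_eq_curv (x : E n) (j k l m : Fin n) :
    riemann γ x j k l m = (γ x * curv γ l m x) j k := by
  simp [riemann, riemannUp_eq_curv, Matrix.mul_apply]

theorem curv_antisymm (x : E n) (l m : Fin n) : curv γ l m x = -curv γ m l x := by
  simp only [curv]
  abel

namespace IsMetricOn

theorem nhds (hγ : IsMetricOn γ U) (hx : x ∈ U) : U ∈ 𝓝 x := hγ.isOpen.mem_nhds hx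

theorem mul_inv (hγ : IsMetricOn γ U) (hx : x ∈ U) : γ x * (γ x)⁻¹ = 1 :=
  Matrix.mul_nonsing_inv _ (isUnit_iff_ne_zero.2 (hγ.det_ne_zero x hx))

theorem inv_mul (hγ : IsMetricOn γ U) (hx : x ∈ U) : (γ x)⁻¹ * γ x = 1 :=
  Matrix.nonsing_inv_mul _ (isUnit_iff_ne_zero.2 (hγ.det_ne_zero x hx))

theorem inv_isSymm (hγ : IsMetricOn γ U) (hx : x ∈ U) : ((γ x)⁻¹).IsSymm := by
  rw [Matrix.IsSymm, Matrix.transpose_nonsing_inv, hγ.symm x hx]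

theorem pd_symm (hγ : IsMetricOn γ U) (hx : x ∈ U) (a i j : Fin n) :
    pd a (fun y => γ y i j) x = pd a (fun y => γ y j i) x :=
  pd_congr a (mem_of_superset (hγ.nhds hx) fun y hy => (hγ.symm y hy).apply j i)

theorem christoffel_symm (hγ : IsMetricOn γ U) (hx : x ∈ U) (k i j : Fin n) :
    christoffel γ x k i j = christoffel γ x k j i := by
  simp only [christoffel]
  congr 1
  refine Finset.sum_congr rfl fun l _ => ?_
  rw [hγ.pd_symm hx l i j]
  ring

theorem smooth_inv (hγ : IsMetricOn γ U) (hx : x ∈ U) : SmoothM (fun y => (γ y)⁻¹) x :=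
  (hγ.smooth x hx).inv (hγ.det_ne_zero x hx)

theorem smooth_conn (hγ : IsMetricOn γ U) (hx : x ∈ U) (i : Fin n) : SmoothM (conn γ i) x := by
  intro k j
  simp only [conn, christoffel, Matrix.of_apply]
  refine contDiffAt_const.mul (ContDiffAt.sum fun l _ => (hγ.smooth_inv hx k l).mul ?_)
  have h : ∀ a b c : Fin n, ContDiffAt ℝ ∞ (fun y => pd a (fun z => γ z b c) y) x :=
    fun a b c => contDiffAt_pd (hγ.smooth x hx b c) a
  exact ((h _ _ _).add (h _ _ _)).sub (h _ _ _)

/-- The Christoffel symbols with all indices lowered. -/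
theorem mul_conn_apply (hγ : IsMetricOn γ U) (hx : x ∈ U) (i l j : Fin n) :
    (γ x * conn γ i x) l j
      = (1 / 2) * (pd i (fun y => γ y j l) x + pd j (fun y => γ y i l) x
          - pd l (fun y => γ y i j) x) := by
  set w : Fin n → ℝ := fun l => pd i (fun y => γ y j l) x + pd j (fun y => γ y i l) x
          - pd l (fun y => γ y i j) x with hw
  have h1 : (fun k => conn γ i x k j) = (1 / 2 : ℝ) • ((γ x)⁻¹ *ᵥ w) := by
    ext k
    simp [conn, christoffel, Matrix.mulVec, dotProduct, hw]
  have h2 : (γ x * conn γ i x) l j = (γ x *ᵥ (fun k => conn γ i x k j)) l := rfl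
  rw [h2, h1, Matrix.mulVec_smul, Matrix.mulVec_mulVec, hγ.mul_inv hx, Matrix.one_mulVec]
  rfl

/-- The metric is parallel. -/
theorem pdM_eq (hγ : IsMetricOn γ U) (hx : x ∈ U) (i : Fin n) :
    pdM i γ x = (conn γ i x)ᵀ * γ x + γ x * conn γ i x := by
  have h : (conn γ i x)ᵀ * γ x = (γ x * conn γ i x)ᵀ := by
    rw [Matrix.transpose_mul, hγ.symm x hx]
  ext j k
  rw [h, Matrix.add_apply, Matrix.transpose_apply, hγ.mul_conn_apply hx, hγ.mul_conn_apply hx,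
    hγ.pd_symm hx i k j, hγ.pd_symm hx k i j, hγ.pd_symm hx j i k]
  simp only [pdM, Matrix.of_apply]
  ring

/-- Since the metric is parallel, the product rule for γΓ absorbs the terms γΓΓ. Only derivatives of
the lowered symbols remain, and these contain no inverse metric. -/
theorem mul_curv (hγ : IsMetricOn γ U) (hx : x ∈ U) (l m : Fin n) :
    γ x * curv γ l m x = pdM l (fun y => γ y * conn γ m y) x - pdM m (fun y => γ y * conn γ l y) x
      - (conn γ l x)ᵀ * γ x * conn γ m x + (conn γ m x)ᵀ * γ x * conn γ l x := by
  rw [pdM_mul l (hγ.smooth x hx) (hγ.smooth_conn hx m),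
    pdM_mul m (hγ.smooth x hx) (hγ.smooth_conn hx l), hγ.pdM_eq hx l, hγ.pdM_eq hx m, curv]
  noncomm_ring

theorem pd_mul_conn (hγ : IsMetricOn γ U) (hx : x ∈ U) (l m j k : Fin n) :
    pdM l (fun y => γ y * conn γ m y) x j k
      = (1 / 2) * (pd l (pd m (fun y => γ y k j)) x + pd l (pd k (fun y => γ y m j)) x
          - pd l (pd j (fun y => γ y m k)) x) := by
  have h : ∀ a b c : Fin n, DifferentiableAt ℝ (fun y => pd a (fun z => γ z b c) y) x :=
    fun a b c => differentiableAt_of_smooth (contDiffAt_pd (hγ.smooth x hx b c) a)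
  have h1 : pdM l (fun y => γ y * conn γ m y) x j k
      = pd l (fun y => (1 / 2) * (pd m (fun z => γ z k j) y + pd k (fun z => γ z m j) y
          - pd j (fun z => γ z m k) y)) x :=
    pd_congr l (mem_of_superset (hγ.nhds hx) fun y hy => hγ.mul_conn_apply hy m j k)
  rw [h1, pd_mul l (differentiableAt_const _) (((h _ _ _).fun_add (h _ _ _)).fun_sub (h _ _ _)),
    pd_const, pd_sub l ((h _ _ _).fun_add (h _ _ _)) (h _ _ _), pd_add l (h _ _ _) (h _ _ _)]
  ring

/-- The classical expression by second derivatives of the metric and a quadratic form in Γ, from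
which the pair symmetry can be read off. -/
theorem riemann_eq (hγ : IsMetricOn γ U) (hx : x ∈ U) (j k l m : Fin n) :
    riemann γ x j k l m
      = (1 / 2) * (pd l (pd k (fun y => γ y m j)) x - pd l (pd j (fun y => γ y m k)) x
          - pd m (pd k (fun y => γ y l j)) x + pd m (pd j (fun y => γ y l k)) x)
        - ((conn γ l x)ᵀ * γ x * conn γ m x) j k + ((conn γ m x)ᵀ * γ x * conn γ l x) j k := by
  rw [riemann_eq_curv, hγ.mul_curv hx]
  simp only [Matrix.add_apply, Matrix.sub_apply]
  rw [hγ.pd_mul_conn hx, hγ.pd_mul_conn hx, pd_comm (hγ.smooth x hx k j) m l]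
  ring

theorem conn_form_swap (hγ : IsMetricOn γ U) (hx : x ∈ U) (j k l m : Fin n) :
    ((conn γ l x)ᵀ * γ x * conn γ m x) j k = ((conn γ m x)ᵀ * γ x * conn γ l x) k j := by
  have : (conn γ m x)ᵀ * γ x * conn γ l x = ((conn γ l x)ᵀ * γ x * conn γ m x)ᵀ := by
    rw [Matrix.transpose_mul, Matrix.transpose_mul, Matrix.transpose_transpose, hγ.symm x hx,
      Matrix.mul_assoc]
  rw [this, Matrix.transpose_apply]

/-- The entry is γ_{pq} Γ^p_{lj} Γ^q_{mk}; vanishing torsion allows l, j and m, k to be exchanged.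
-/
theorem conn_form_pair (hγ : IsMetricOn γ U) (hx : x ∈ U) (j k l m : Fin n) :
    ((conn γ l x)ᵀ * γ x * conn γ m x) j k = ((conn γ j x)ᵀ * γ x * conn γ k x) l m := by
  simp only [Matrix.mul_apply, Matrix.transpose_apply, conn, Matrix.of_apply]
  simp only [hγ.christoffel_symm hx _ l j, hγ.christoffel_symm hx _ m k]

/-- `R_{jklm} = R_{lmjk}`. -/
theorem riemann_pair (hγ : IsMetricOn γ U) (hx : x ∈ U) (j k l m : Fin n) :
    riemann γ x j k l m = riemann γ x l m j k := by
  have hs : ∀ a b c d : Fin n, pd a (pd b (fun y => γ y c d)) x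
      = pd b (pd a (fun y => γ y d c)) x := by
    intro a b c d
    rw [pd_comm (hγ.smooth x hx c d) a b]
    exact pd_congr b (mem_of_superset (hγ.nhds hx) fun y hy => hγ.pd_symm hy a c d)
  rw [hγ.riemann_eq hx, hγ.riemann_eq hx, hγ.conn_form_pair hx j k l m,
    hγ.conn_form_pair hx j k m l, hγ.conn_form_swap hx m l j k,
    hs l k m j, hs l j m k, hs m k l j, hs m j l k]
  have hs' : ∀ a b c d : Fin n, pd a (pd b (fun y => γ y c d)) x
      = pd a (pd b (fun y => γ y d c)) x := fun a b c d => by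
    rw [hs a b c d, pd_comm (hγ.smooth x hx d c) b a]
  rw [hs' k l j m, hs' j l k m, hs' k m j l, hs' j m k l]
  ring

theorem riemann_antisymm_right (x : E n) (j k l m : Fin n) :
    riemann γ x j k l m = -riemann γ x j k m l := by
  rw [riemann_eq_curv, riemann_eq_curv, curv_antisymm, Matrix.mul_neg, Matrix.neg_apply]

theorem riemann_antisymm_left (hγ : IsMetricOn γ U) (hx : x ∈ U) (j k l m : Fin n) :
    riemann γ x j k l m = -riemann γ x k j l m := by
  rw [hγ.riemann_pair hx, riemann_antisymm_right, ← hγ.riemann_pair hx]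

theorem riemannUp_eq_inv (hγ : IsMetricOn γ U) (hx : x ∈ U) (p k l m : Fin n) :
    riemannUp γ x p k l m = ∑ j, (γ x)⁻¹ p j * riemann γ x j k l m := by
  simp only [riemannUp_eq_curv, riemann_eq_curv]
  rw [← Matrix.mul_apply, ← Matrix.mul_assoc, hγ.inv_mul hx, Matrix.one_mul]

/-- `R_{km} = g^{jl} R_{jklm}`. -/
theorem ricci_eq (hγ : IsMetricOn γ U) (hx : x ∈ U) (k m : Fin n) :
    ricci γ x k m = ∑ l, ∑ j, (γ x)⁻¹ l j * riemann γ x j k l m := by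
  simp only [ricci, hγ.riemannUp_eq_inv hx]

end IsMetricOn

end LeviCivita

end StaticCKG

namespace StaticCKG

open Matrix Filter Topology

/-! ### Static metrics in a coordinate domain -/

section Static

variable {n : ℕ}

/-- The metric `γ` is static on `U` with velocity `v`. -/
structure IsStaticOn (γ : E n → Matrix (Fin n) (Fin n) ℝ) (v : E n → Fin n → ℝ)
    (U : Set (E n)) : Prop extends IsMetricOn γ U where
  smooth_vel : ∀ x ∈ U, SmoothV v x
  unit : ∀ x ∈ U, lower γ v x ⬝ᵥ v x = -1
  covDeriv_vel : ∀ x ∈ U, ∀ i j,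
    covDeriv γ (lower γ v) x i j = -lower γ v x i * accel γ v x j

/-- Twice the Einstein tensor evaluated on the velocity, `2 G_{kl} v^k v^l`. -/
noncomputable def spatialScalar (γ : E n → Matrix (Fin n) (Fin n) ℝ) (v : E n → Fin n → ℝ)
    (x : E n) : ℝ :=
  2 * (v x ⬝ᵥ (Matrix.of (einstein γ x) *ᵥ v x))

/-- The tidal tensor `A_{ij} = a_i a_j + ∇_i a_j` of the acceleration `a`. -/
noncomputable def tidal (γ : E n → Matrix (Fin n) (Fin n) ℝ) (v : E n → Fin n → ℝ) (x : E n) :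
    Matrix (Fin n) (Fin n) ℝ :=
  Matrix.of fun i j => accel γ v x i * accel γ v x j + covDeriv γ (accel γ v) x i j

variable {γ : E n → Matrix (Fin n) (Fin n) ℝ} {v : E n → Fin n → ℝ} {U : Set (E n)} {x : E n}

theorem covDeriv_eq (γ : E n → Matrix (Fin n) (Fin n) ℝ) (α : E n → Fin n → ℝ) (x : E n)
    (i : Fin n) : covDeriv γ α x i = pdV i α x - α x ᵥ* conn γ i x := by
  ext j
  simp [covDeriv, pdV, conn, Matrix.vecMul, dotProduct, mul_comm]

theorem lower_eq_mulVec (γ : E n → Matrix (Fin n) (Fin n) ℝ) (v : E n → Fin n → ℝ) (x : E n) :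
    lower γ v x = γ x *ᵥ v x := rfl

theorem etaScalar_eq (γ : E n → Matrix (Fin n) (Fin n) ℝ) (x : E n) :
    etaScalar γ v x = accel γ v x ⬝ᵥ ((γ x)⁻¹ *ᵥ accel γ v x) := by
  simp only [etaScalar, dotProduct, Matrix.mulVec, Finset.mul_sum]
  exact Finset.sum_congr rfl fun k _ => Finset.sum_congr rfl fun l _ => by ring

theorem IsMetricOn.lower_eq_vecMul (hγ : IsMetricOn γ U) (hx : x ∈ U) (v : E n → Fin n → ℝ) :
    lower γ v x = v x ᵥ* γ x := by
  rw [lower_eq_mulVec, ← Matrix.vecMul_transpose, hγ.symm x hx]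

theorem IsMetricOn.inv_mulVec_lower (hγ : IsMetricOn γ U) (hx : x ∈ U) (v : E n → Fin n → ℝ) :
    (γ x)⁻¹ *ᵥ lower γ v x = v x := by
  rw [lower_eq_mulVec, Matrix.mulVec_mulVec, hγ.inv_mul hx, Matrix.one_mulVec]

theorem IsMetricOn.smooth_lower (hγ : IsMetricOn γ U) (hx : x ∈ U) (hv : SmoothV v x) :
    SmoothV (lower γ v) x :=
  fun k => ContDiffAt.sum fun l _ => (hγ.smooth x hx k l).mul (hv l)

theorem IsMetricOn.smooth_accel (hγ : IsMetricOn γ U) (hx : x ∈ U) (hv : SmoothV v x) :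
    SmoothV (accel γ v) x := by
  refine fun k => ContDiffAt.sum fun j _ => (hv j).mul ?_
  simp only [covDeriv_eq]
  exact ((hγ.smooth_lower hx hv).pdV j k).sub
    ((hγ.smooth_lower hx hv).vecMul (hγ.smooth_conn hx j) k)

theorem IsMetricOn.ricci_symm (hγ : IsMetricOn γ U) (hx : x ∈ U) (k m : Fin n) :
    ricci γ x k m = ricci γ x m k := by
  rw [hγ.ricci_eq hx, hγ.ricci_eq hx, Finset.sum_comm]
  refine Finset.sum_congr rfl fun j _ => Finset.sum_congr rfl fun l _ => ?_
  rw [hγ.riemann_pair hx, (hγ.inv_isSymm hx).apply]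

theorem IsMetricOn.einstein_isSymm (hγ : IsMetricOn γ U) (hx : x ∈ U) :
    (Matrix.of (einstein γ x)).IsSymm := by
  ext k m
  simp only [Matrix.transpose_apply, Matrix.of_apply, einstein]
  rw [hγ.ricci_symm hx, (hγ.symm x hx).apply]

theorem IsMetricOn.einsteinUp_eq (hγ : IsMetricOn γ U) (hx : x ∈ U) :
    Matrix.of (einsteinUp γ x) = (γ x)⁻¹ * Matrix.of (einstein γ x) * (γ x)⁻¹ := by
  ext k l
  simp only [Matrix.mul_apply, Matrix.of_apply, einsteinUp, Finset.sum_mul]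
  rw [Finset.sum_comm]
  refine Finset.sum_congr rfl fun q _ => Finset.sum_congr rfl fun p _ => ?_
  rw [(hγ.inv_isSymm hx).apply l q]
  ring

theorem IsMetricOn.einsteinUp_isSymm (hγ : IsMetricOn γ U) (hx : x ∈ U) :
    (Matrix.of (einsteinUp γ x)).IsSymm := by
  rw [hγ.einsteinUp_eq hx, Matrix.IsSymm, Matrix.transpose_mul, Matrix.transpose_mul,
    hγ.inv_isSymm hx, hγ.einstein_isSymm hx, Matrix.mul_assoc]

namespace IsStaticOn

theorem pdV_lower (h : IsStaticOn γ v U) (hx : x ∈ U) (i : Fin n) :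
    pdV i (lower γ v) x = lower γ v x ᵥ* conn γ i x - lower γ v x i • accel γ v x := by
  have h1 : covDeriv γ (lower γ v) x i = -(lower γ v x i • accel γ v x) := by
    ext j
    rw [h.covDeriv_vel x hx, Pi.neg_apply, Pi.smul_apply, smul_eq_mul, neg_mul]
  rw [covDeriv_eq] at h1
  rw [eq_add_of_sub_eq h1]
  abel

/-- The Ricci identity for the velocity. -/
theorem lower_vecMul_curv (h : IsStaticOn γ v U) (hx : x ∈ U) (j i : Fin n) :
    lower γ v x ᵥ* curv γ j i x
      = lower γ v x i • tidal γ v x j - lower γ v x j • tidal γ v x i := by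
  have hω := h.smooth_lower hx (h.smooth_vel x hx)
  have ha := h.smooth_accel hx (h.smooth_vel x hx)
  -- The static condition differentiated once more. The term a ⊗ a of the tidal tensor arises where
  -- the derivative falls on the factor u_i of u_i a.
  have key : ∀ j i : Fin n, pdV j (pdV i (lower γ v)) x
      = (lower γ v x ᵥ* conn γ j x - lower γ v x j • accel γ v x) ᵥ* conn γ i x
        + lower γ v x ᵥ* pdM j (conn γ i) x
        - (((lower γ v x ᵥ* conn γ j x) i - lower γ v x j * accel γ v x i) • accel γ v x
          + lower γ v x i • pdV j (accel γ v) x) := by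
    intro j i
    rw [pdV_congr j (w := fun y => lower γ v y ᵥ* conn γ i y - lower γ v y i • accel γ v y)
        (mem_of_superset (h.nhds hx) fun y hy => h.pdV_lower hy i),
      pdV_sub j (hω.vecMul (h.smooth_conn hx i)) (SmoothV.smul (hω i) ha),
      pdV_vecMul j hω (h.smooth_conn hx i), pdV_smul j (hω i) ha, h.pdV_lower hx]
    have := congrFun (h.pdV_lower hx j) i
    simp only [pdV, Pi.sub_apply, Pi.smul_apply, smul_eq_mul] at this
    rw [this]
  have hswap : (lower γ v x ᵥ* conn γ j x) i = (lower γ v x ᵥ* conn γ i x) j := by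
    simp only [Matrix.vecMul, dotProduct, conn, Matrix.of_apply]
    exact Finset.sum_congr rfl fun k _ => by rw [h.christoffel_symm hx]
  have hA : ∀ i, tidal γ v x i = accel γ v x i • accel γ v x
      + (pdV i (accel γ v) x - accel γ v x ᵥ* conn γ i x) := by
    intro i
    rw [← covDeriv_eq]
    rfl
  -- Equality of the mixed derivatives is the integrability condition; `hswap` (vanishing torsion)
  -- removes the term that is symmetric in i and j.
  have h0 := pdV_comm hω j i
  rw [key, key, hswap] at h0
  rw [hA, hA]
  simp only [curv, Matrix.vecMul_add, Matrix.vecMul_sub, Matrix.sub_vecMul, ← Matrix.vecMul_vecMul,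
    Matrix.smul_vecMul, sub_smul, smul_add, smul_sub, smul_smul] at h0 ⊢
  linear_combination (exp := 1) h0

/-- The covariant derivative of the velocity as a vector. -/
theorem pdV_vel (h : IsStaticOn γ v U) (hx : x ∈ U) (i : Fin n) :
    pdV i v x = -(lower γ v x i • ((γ x)⁻¹ *ᵥ accel γ v x)) - conn γ i x *ᵥ v x := by
  have h1 : pdV i (lower γ v) x = pdV i v x ᵥ* γ x + v x ᵥ* pdM i γ x := by
    rw [← pdV_vecMul i (h.smooth_vel x hx) (h.smooth x hx)]
    exact pdV_congr i (mem_of_superset (h.nhds hx) fun y hy => h.lower_eq_vecMul hy v)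
  rw [h.pdV_lower hx, h.pdM_eq hx, Matrix.vecMul_add, ← Matrix.vecMul_vecMul,
    ← Matrix.vecMul_vecMul, ← h.lower_eq_vecMul hx v, Matrix.vecMul_transpose] at h1
  have h2 : (pdV i v x + conn γ i x *ᵥ v x) ᵥ* γ x = -(lower γ v x i • accel γ v x) := by
    rw [Matrix.add_vecMul]
    linear_combination (exp := 1) -h1
  have h3 := congrArg (· ᵥ* (γ x)⁻¹) h2
  simp only [Matrix.vecMul_vecMul, h.mul_inv hx, Matrix.vecMul_one] at h3
  rw [eq_sub_iff_add_eq, h3, Matrix.neg_vecMul, Matrix.smul_vecMul, ← Matrix.mulVec_transpose,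
    h.inv_isSymm hx]

/-- The acceleration is orthogonal to the velocity. -/
theorem accel_dotProduct (h : IsStaticOn γ v U) (hx : x ∈ U) : accel γ v x ⬝ᵥ v x = 0 := by
  -- The derivative of u·u = -1 is -2 u_i (a·u). Contracting with u^i then removes the factor u_i.
  have key : ∀ i, lower γ v x i * (accel γ v x ⬝ᵥ v x) = 0 := by
    intro i
    have h0 : pd i (fun y => lower γ v y ⬝ᵥ v y) x = 0 := by
      rw [pd_congr i (g := fun _ => -1) (mem_of_superset (h.nhds hx) fun y hy => h.unit y hy),
        pd_const]
    rw [pd_dotProduct i (h.smooth_lower hx (h.smooth_vel x hx)) (h.smooth_vel x hx),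
      h.pdV_lower hx, h.pdV_vel hx] at h0
    have h4 : lower γ v x ⬝ᵥ ((γ x)⁻¹ *ᵥ accel γ v x) = accel γ v x ⬝ᵥ v x := by
      rw [Matrix.dotProduct_mulVec, ← Matrix.mulVec_transpose, h.inv_isSymm hx,
        h.inv_mulVec_lower hx, dotProduct_comm]
    rw [sub_dotProduct, dotProduct_sub, dotProduct_neg, smul_dotProduct, dotProduct_smul, h4,
      ← Matrix.dotProduct_mulVec] at h0
    simp only [smul_eq_mul] at h0
    linarith
  have h1 : (lower γ v x ⬝ᵥ v x) * (accel γ v x ⬝ᵥ v x) = 0 := by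
    rw [dotProduct, Finset.sum_mul]
    exact Finset.sum_eq_zero fun i _ => by rw [mul_right_comm, key, zero_mul]
  rw [h.unit x hx] at h1
  linarith

/-- Differentiating a·u = 0 gives u^j ∇_i a_j = -a^j ∇_i u_j = η u_i, and the part a ⊗ a kills u. -/
theorem tidal_mulVec (h : IsStaticOn γ v U) (hx : x ∈ U) :
    tidal γ v x *ᵥ v x = etaScalar γ v x • lower γ v x := by
  ext i
  have h0 : pd i (fun y => accel γ v y ⬝ᵥ v y) x = 0 := by
    rw [pd_congr i (g := fun _ => 0)
      (mem_of_superset (h.nhds hx) fun y hy => h.accel_dotProduct hy), pd_const]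
  rw [pd_dotProduct i (h.smooth_accel hx (h.smooth_vel x hx)) (h.smooth_vel x hx),
    h.pdV_vel hx, dotProduct_sub, dotProduct_neg, dotProduct_smul,
    ← etaScalar_eq, Matrix.dotProduct_mulVec] at h0
  have h1 : (tidal γ v x *ᵥ v x) i = accel γ v x i * (accel γ v x ⬝ᵥ v x)
      + covDeriv γ (accel γ v) x i ⬝ᵥ v x := by
    simp only [Matrix.mulVec, tidal, dotProduct, Matrix.of_apply, add_mul, Finset.sum_add_distrib,
      Finset.mul_sum, mul_assoc]
  rw [h1, h.accel_dotProduct hx, covDeriv_eq, sub_dotProduct, Pi.smul_apply]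
  simp only [smul_eq_mul] at h0 ⊢
  linarith

/-- Contraction of the curvature with the velocity. -/
theorem sum_vel_riemann (h : IsStaticOn γ v U) (hx : x ∈ U) (k l m : Fin n) :
    ∑ j, v x j * riemann γ x j k l m
      = lower γ v x m * tidal γ v x l k - lower γ v x l * tidal γ v x m k := by
  have h1 : ∑ j, v x j * riemann γ x j k l m = (v x ᵥ* (γ x * curv γ l m x)) k := by
    simp only [riemann_eq_curv, Matrix.vecMul, dotProduct]
  rw [h1, ← Matrix.vecMul_vecMul, ← h.lower_eq_vecMul hx, h.lower_vecMul_curv hx]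
  rfl

/-- The velocity is an eigenvector of the Ricci tensor. -/
theorem exists_ricci_mulVec (h : IsStaticOn γ v U) (hx : x ∈ U) :
    ∃ c : ℝ, Matrix.of (ricci γ x) *ᵥ v x = c • lower γ v x := by
  -- The eigenvalue is η - tr A: in the trace of `h1`, one term is A applied to u and the other is
  -- the trace of A times u.
  refine ⟨etaScalar γ v x - ∑ l, ∑ j, (γ x)⁻¹ l j * tidal γ v x j l, ?_⟩
  ext k
  have h1 : ∀ j l : Fin n, ∑ m, riemann γ x j k l m * v x m
      = lower γ v x j * tidal γ v x k l - lower γ v x k * tidal γ v x j l := by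
    intro j l
    have : ∑ m, riemann γ x j k l m * v x m = -∑ m, v x m * riemann γ x m l j k := by
      rw [← Finset.sum_neg_distrib]
      refine Finset.sum_congr rfl fun m _ => ?_
      rw [h.riemann_pair hx, h.riemann_antisymm_left hx]
      ring
    rw [this, h.sum_vel_riemann hx]
    ring
  have h2 : (Matrix.of (ricci γ x) *ᵥ v x) k
      = ∑ l, ∑ j, (γ x)⁻¹ l j * ∑ m, riemann γ x j k l m * v x m := by
    simp only [Matrix.mulVec, dotProduct, Matrix.of_apply, h.ricci_eq hx, Finset.sum_mul,
      Finset.mul_sum]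
    rw [Finset.sum_comm]
    refine Finset.sum_congr rfl fun l _ => ?_
    rw [Finset.sum_comm]
    exact Finset.sum_congr rfl fun j _ => Finset.sum_congr rfl fun m _ => by ring
  have h3 : ∑ l, ∑ j, (γ x)⁻¹ l j * (lower γ v x j * tidal γ v x k l)
      = etaScalar γ v x * lower γ v x k := by
    have : (tidal γ v x *ᵥ ((γ x)⁻¹ *ᵥ lower γ v x)) k
        = ∑ l, ∑ j, (γ x)⁻¹ l j * (lower γ v x j * tidal γ v x k l) := by
      simp only [Matrix.mulVec, dotProduct, Finset.mul_sum]
      exact Finset.sum_congr rfl fun l _ => Finset.sum_congr rfl fun m _ => by ring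
    rw [← this, h.inv_mulVec_lower hx, h.tidal_mulVec hx]
    rfl
  rw [h2]
  simp only [h1, mul_sub, Finset.sum_sub_distrib, h3, Pi.smul_apply, smul_eq_mul, sub_mul,
    Finset.sum_mul]
  congr 1
  exact Finset.sum_congr rfl fun l _ => Finset.sum_congr rfl fun m _ => by ring

/-- The velocity is an eigenvector of the Einstein tensor. -/
theorem einstein_mulVec (h : IsStaticOn γ v U) (hx : x ∈ U) :
    Matrix.of (einstein γ x) *ᵥ v x = (-(1 / 2) * spatialScalar γ v x) • lower γ v x := by
  obtain ⟨c, hc⟩ := h.exists_ricci_mulVec hx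
  have h1 : Matrix.of (einstein γ x)
      = Matrix.of (ricci γ x) - (1 / 2 * scalarCurv γ x) • γ x := rfl
  have h2 : Matrix.of (einstein γ x) *ᵥ v x = (c - 1 / 2 * scalarCurv γ x) • lower γ v x := by
    rw [h1, Matrix.sub_mulVec, hc, Matrix.smul_mulVec, ← lower_eq_mulVec, sub_smul]
  -- Pairing with u turns the eigenvalue c' into G(u,u) = -c', because u·u = -1; hence c' = -s/2.
  rw [spatialScalar, h2, dotProduct_smul, dotProduct_comm, h.unit x hx]
  congr 1
  simp

theorem einsteinUp_mulVec (h : IsStaticOn γ v U) (hx : x ∈ U) :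
    Matrix.of (einsteinUp γ x) *ᵥ lower γ v x = (-(1 / 2) * spatialScalar γ v x) • v x := by
  rw [h.einsteinUp_eq hx, ← Matrix.mulVec_mulVec, h.inv_mulVec_lower hx, ← Matrix.mulVec_mulVec,
    h.einstein_mulVec hx, Matrix.mulVec_smul, h.inv_mulVec_lower hx]

/-- Pair symmetry brings the velocity to the first slot of the curvature, where the Ricci identity
applies. One term contracts G with A; in the other G acts on u, giving -s/2, and then A gives η. -/
theorem sum_riemann_einsteinUp (h : IsStaticOn γ v U) (hx : x ∈ U) (k : Fin n) :
    ∑ l, (∑ j, ∑ m, riemann γ x j k l m * einsteinUp γ x m j) * v x l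
      = ((∑ j, ∑ m, einsteinUp γ x j m * tidal γ v x j m)
          + 1 / 2 * spatialScalar γ v x * etaScalar γ v x) * lower γ v x k := by
  have h1 : ∑ l, (∑ j, ∑ m, riemann γ x j k l m * einsteinUp γ x m j) * v x l
      = ∑ j, ∑ m, einsteinUp γ x m j * ∑ l, v x l * riemann γ x l m j k := by
    simp only [Finset.sum_mul, Finset.mul_sum]
    rw [Finset.sum_comm]
    refine Finset.sum_congr rfl fun j _ => ?_
    rw [Finset.sum_comm]
    refine Finset.sum_congr rfl fun m _ => Finset.sum_congr rfl fun l _ => ?_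
    rw [h.riemann_pair hx j k l m]
    ring
  have h2 : ∑ j, ∑ m, einsteinUp γ x m j * (lower γ v x j * tidal γ v x k m)
      = -(1 / 2) * spatialScalar γ v x * etaScalar γ v x * lower γ v x k := by
    have : (tidal γ v x *ᵥ (Matrix.of (einsteinUp γ x) *ᵥ lower γ v x)) k
        = ∑ j, ∑ m, einsteinUp γ x m j * (lower γ v x j * tidal γ v x k m) := by
      simp only [Matrix.mulVec, dotProduct, Finset.mul_sum, Matrix.of_apply]
      rw [Finset.sum_comm]
      exact Finset.sum_congr rfl fun l _ => Finset.sum_congr rfl fun m _ => by ring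
    rw [← this, h.einsteinUp_mulVec hx, Matrix.mulVec_smul, h.tidal_mulVec hx]
    simp only [Pi.smul_apply, smul_eq_mul]
    ring
  rw [h1]
  simp only [h.sum_vel_riemann hx, mul_sub, Finset.sum_sub_distrib, h2]
  rw [add_mul, Finset.sum_mul]
  have h3 : ∑ j, ∑ m, einsteinUp γ x m j * (lower γ v x k * tidal γ v x j m)
      = ∑ j, (∑ m, einsteinUp γ x j m * tidal γ v x j m) * lower γ v x k := by
    refine Finset.sum_congr rfl fun j _ => ?_
    rw [Finset.sum_mul]
    refine Finset.sum_congr rfl fun m _ => ?_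
    have := (h.einsteinUp_isSymm hx).apply j m
    simp only [Matrix.of_apply] at this
    rw [this]
    ring
  rw [h3]
  ring

/-- The Altas–Tekin current of a static metric is proportional to the velocity. -/
theorem altasTekin_vel (h : IsStaticOn γ v U) (hx : x ∈ U) (k : Fin n) :
    ∑ l, altasTekin γ x k l * v x l
      = phiScalar γ v (spatialScalar γ v x) x * lower γ v x k := by
  have hG : ∀ k, ∑ l, einstein γ x k l * v x l
      = -(1 / 2) * spatialScalar γ v x * lower γ v x k :=
    fun k => congrFun (h.einstein_mulVec hx) k
  have hGG : ∑ l, (∑ m, ∑ p, (γ x)⁻¹ m p * einstein γ x k m * einstein γ x l p) * v x l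
      = 1 / 4 * spatialScalar γ v x ^ 2 * lower γ v x k := by
    have : (Matrix.of (einstein γ x) *ᵥ ((γ x)⁻¹ *ᵥ (Matrix.of (einstein γ x) *ᵥ v x))) k
        = ∑ l, (∑ m, ∑ p, (γ x)⁻¹ m p * einstein γ x k m * einstein γ x l p) * v x l := by
      simp only [Matrix.mulVec, dotProduct, Finset.mul_sum, Finset.sum_mul, Matrix.of_apply]
      conv_rhs => rw [Finset.sum_comm]
      refine Finset.sum_congr rfl fun m _ => ?_
      conv_rhs => rw [Finset.sum_comm]
      refine Finset.sum_congr rfl fun p _ => Finset.sum_congr rfl fun l _ => ?_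
      have := (h.einstein_isSymm hx).apply l p
      simp only [Matrix.of_apply] at this
      rw [this]
      ring
    rw [← this, h.einstein_mulVec hx, Matrix.mulVec_smul, h.inv_mulVec_lower hx,
      Matrix.mulVec_smul, h.einstein_mulVec hx]
    simp only [Pi.smul_apply, smul_eq_mul]
    ring
  have hg : ∑ l, γ x k l * v x l = lower γ v x k := rfl
  simp only [altasTekin, add_mul, Finset.sum_add_distrib]
  rw [show ∀ c, ∑ l, γ x k l * c * v x l = c * lower γ v x k from fun c => by
    rw [← hg, Finset.mul_sum]; exact Finset.sum_congr rfl fun l _ => by ring]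
  simp only [mul_assoc (4 : ℝ), mul_assoc (2 : ℝ), mul_assoc (4 / 3 : ℝ), mul_assoc (scalarCurv γ x)]
  rw [← Finset.mul_sum, ← Finset.mul_sum, ← Finset.mul_sum, ← Finset.mul_sum, hG, hGG,
    h.sum_riemann_einsteinUp hx, phiScalar]
  simp only [tidal, Matrix.of_apply]
  ring

end IsStaticOn

end Static

end StaticCKG

namespace StaticCKG

open Matrix Filter Topology

/-! ### Hypersurfaces orthogonal to the velocity -/

section Gauss

/-- A frame of a vector `w` with `g(w, w) = -1` and vectors (the columns of `P`) orthogonal to it: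
the Gram matrix of `P` is nondegenerate, and the inverse metric is the sum of its two parts. -/
theorem gram_det_ne_zero_and_inv_eq {n : ℕ} {g : Matrix (Fin (n + 1)) (Fin (n + 1)) ℝ}
    (hg : g.IsSymm) (hdet : g.det ≠ 0) {w : Fin (n + 1) → ℝ} (hw : (g *ᵥ w) ⬝ᵥ w = -1)
    {P : Matrix (Fin (n + 1)) (Fin n) ℝ} (horth : (g *ᵥ w) ᵥ* P = 0)
    (hP : ∀ c, P *ᵥ c = 0 → c = 0) :
    (Pᵀ * g * P).det ≠ 0 ∧ g⁻¹ = P * (Pᵀ * g * P)⁻¹ * Pᵀ - vecMulVec w w := by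
  have hug : IsUnit g.det := isUnit_iff_ne_zero.2 hdet
  -- The square matrix with columns w and P. It is invertible: pairing a relation among its columns
  -- with g w kills the coefficient of w, and P is injective.
  set Q : Matrix (Fin (n + 1)) (Fin (n + 1)) ℝ :=
    Matrix.of fun i => Fin.cons (w i) (P i) with hQ
  have hQc : ∀ c : Fin (n + 1) → ℝ, Q *ᵥ c = c 0 • w + P *ᵥ Fin.tail c := by
    intro c
    ext i
    simp [hQ, Matrix.mulVec, dotProduct, Fin.sum_univ_succ, Fin.tail, mul_comm]
  have hQdet : Q.det ≠ 0 := by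
    intro h0
    obtain ⟨c, hc0, hc⟩ := Matrix.exists_mulVec_eq_zero_iff.2 h0
    rw [hQc] at hc
    have h1 : (g *ᵥ w) ⬝ᵥ (c 0 • w + P *ᵥ Fin.tail c) = 0 := by rw [hc, dotProduct_zero]
    rw [dotProduct_add, dotProduct_smul, hw, Matrix.dotProduct_mulVec, horth,
      zero_dotProduct] at h1
    have h2 : c 0 = 0 := by simpa using h1
    rw [h2, zero_smul, zero_add] at hc
    have h3 := hP _ hc
    exact hc0 (funext fun i => Fin.cases h2 (fun j => congrFun h3 j) i)
  have hcol : ∀ c, Pᵀ *ᵥ (g *ᵥ (P *ᵥ c)) = (Pᵀ * g * P) *ᵥ c := fun c => by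
    simp only [Matrix.mulVec_mulVec, Matrix.mul_assoc]
  -- For c in the kernel of the Gram matrix, P c is orthogonal to the columns of P and to w, hence
  -- to everything, so it vanishes.
  have hh : (Pᵀ * g * P).det ≠ 0 := by
    intro h0
    obtain ⟨c, hc0, hc⟩ := Matrix.exists_mulVec_eq_zero_iff.2 h0
    refine hc0 (hP c ?_)
    have h1 : (g *ᵥ (P *ᵥ c)) ᵥ* Q = 0 := by
      ext j
      refine Fin.cases ?_ (fun b => ?_) j
      · have : ((g *ᵥ (P *ᵥ c)) ᵥ* Q) 0 = (g *ᵥ (P *ᵥ c)) ⬝ᵥ w := rfl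
        rw [this, dotProduct_comm, Matrix.dotProduct_mulVec, ← Matrix.mulVec_transpose, hg,
          Matrix.dotProduct_mulVec, horth, zero_dotProduct]
        rfl
      · have : ((g *ᵥ (P *ᵥ c)) ᵥ* Q) b.succ = (Pᵀ *ᵥ (g *ᵥ (P *ᵥ c))) b := by
          rw [Matrix.mulVec_transpose]
          rfl
        rw [this, hcol, hc]
        rfl
    have h2 : g *ᵥ (P *ᵥ c) = 0 := by
      have := congrArg (· ᵥ* Q⁻¹) h1
      simpa [Matrix.vecMul_vecMul, Matrix.mul_nonsing_inv _ (isUnit_iff_ne_zero.2 hQdet)]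
        using this
    have := congrArg (g⁻¹ *ᵥ ·) h2
    simpa [Matrix.mulVec_mulVec, ← Matrix.mul_assoc, Matrix.nonsing_inv_mul _ hug] using this
  refine ⟨hh, ?_⟩
  -- K g is tested on the basis Q: it fixes P, and it fixes w because the minus sign compensates
  -- g(w, w) = -1.
  set K := P * (Pᵀ * g * P)⁻¹ * Pᵀ - vecMulVec w w with hK
  have hKP : K * g * P = P := by
    have h1 : P * (Pᵀ * g * P)⁻¹ * Pᵀ * g * P = P := by
      have : P * (Pᵀ * g * P)⁻¹ * Pᵀ * g * P = P * ((Pᵀ * g * P)⁻¹ * (Pᵀ * g * P)) := by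
        simp only [Matrix.mul_assoc]
      rw [this, Matrix.nonsing_inv_mul _ (isUnit_iff_ne_zero.2 hh), Matrix.mul_one]
    have h2 : vecMulVec w w * g * P = 0 := by
      have h3 : w ᵥ* g = g *ᵥ w := by rw [← Matrix.vecMul_transpose, hg]
      rw [Matrix.mul_assoc, Matrix.vecMulVec_mul, ← Matrix.vecMul_vecMul, h3, horth]
      ext i j
      simp [vecMulVec_apply]
    rw [hK, Matrix.sub_mul, Matrix.sub_mul, h1, h2, sub_zero]
  have hKw : (K * g) *ᵥ w = w := by
    rw [← Matrix.mulVec_mulVec, hK, Matrix.sub_mulVec, ← Matrix.mulVec_mulVec,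
      Matrix.mulVec_transpose, horth, Matrix.mulVec_zero, Matrix.vecMulVec_mulVec,
      dotProduct_comm, hw]
    simp
  have hKQ : K * g * Q = Q := by
    ext i j
    refine Fin.cases ?_ (fun b => ?_) j
    · exact congrFun hKw i
    · exact congrFun (congrFun hKP i) b
  have hK1 : K * g = 1 := by
    have := congrArg (· * Q⁻¹) hKQ
    simpa [Matrix.mul_assoc, Matrix.mul_nonsing_inv _ (isUnit_iff_ne_zero.2 hQdet)] using this
  exact Matrix.inv_eq_left_inv hK1

/-! ### Pull-back of the connection along a map, and the Gauss equation. -/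

variable {n m : ℕ}

/-- The Jacobian matrix of a map between coordinate spaces. -/
noncomputable def jac (ψ : E m → E n) (y : E m) : Matrix (Fin n) (Fin m) ℝ :=
  Matrix.of fun i a => pd a (fun z => ψ z i) y

theorem jac_mulVec {ψ : E m → E n} {y : E m} (hψ : DifferentiableAt ℝ ψ y) (c : E m) :
    jac ψ y *ᵥ c = fderiv ℝ ψ y c := by
  ext i
  have h2 : HasFDerivAt (fun z => ψ z i)
      ((EuclideanSpace.proj i : E n →L[ℝ] ℝ).comp (fderiv ℝ ψ y)) y :=
    (EuclideanSpace.proj i : E n →L[ℝ] ℝ).hasFDerivAt.comp y hψ.hasFDerivAt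
  have h3 := fderiv_eq_sum_pd (fun z => ψ z i) y c
  rw [h2.fderiv] at h3
  change fderiv ℝ ψ y c i = _ at h3
  rw [h3]
  simp only [jac, Matrix.mulVec, dotProduct, Matrix.of_apply]
  exact Finset.sum_congr rfl fun a _ => mul_comm _ _

theorem smooth_jac {ψ : E m → E n} {y : E m} (hψ : ContDiffAt ℝ ∞ ψ y) : SmoothM (jac ψ) y :=
  fun i a => contDiffAt_pd (contDiffAt_euclidean.1 hψ i) a

theorem pd_jac_comm {ψ : E m → E n} {y : E m} (hψ : ContDiffAt ℝ ∞ ψ y) (a b : Fin m)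
    (i : Fin n) : pdM a (jac ψ) y i b = pdM b (jac ψ) y i a :=
  pd_comm (contDiffAt_euclidean.1 hψ i) a b

theorem SmoothM.comp {ι κ : Type*} {M : E n → Matrix ι κ ℝ} {ψ : E m → E n} {y : E m}
    (hM : SmoothM M (ψ y)) (hψ : ContDiffAt ℝ ∞ ψ y) : SmoothM (fun z => M (ψ z)) y :=
  fun i j => (hM i j).comp y hψ

theorem SmoothV.comp {ι : Type*} {w : E n → ι → ℝ} {ψ : E m → E n} {y : E m}
    (hw : SmoothV w (ψ y)) (hψ : ContDiffAt ℝ ∞ ψ y) : SmoothV (fun z => w (ψ z)) y :=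
  fun i => (hw i).comp y hψ

theorem pdM_comp {ι κ : Type*} {M : E n → Matrix ι κ ℝ} {ψ : E m → E n} {y : E m}
    (hM : SmoothM M (ψ y)) (hψ : ContDiffAt ℝ ∞ ψ y) (a : Fin m) :
    pdM a (fun z => M (ψ z)) y = ∑ i, jac ψ y i a • pdM i M (ψ y) := by
  ext k l
  rw [Matrix.sum_apply]
  exact pd_comp a (differentiableAt_of_smooth (hM k l)) (differentiableAt_of_smooth hψ)

theorem pdV_comp {ι : Type*} {w : E n → ι → ℝ} {ψ : E m → E n} {y : E m}
    (hw : SmoothV w (ψ y)) (hψ : ContDiffAt ℝ ∞ ψ y) (a : Fin m) :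
    pdV a (fun z => w (ψ z)) y = ∑ i, jac ψ y i a • pdV i w (ψ y) := by
  ext k
  rw [Finset.sum_apply]
  exact pd_comp a (differentiableAt_of_smooth (hw k)) (differentiableAt_of_smooth hψ)

/-- The pull-back `A_a = ∂_a ψ^i Γ_i` of the connection along `ψ`. -/
noncomputable def pullConn (γ : E n → Matrix (Fin n) (Fin n) ℝ) (ψ : E m → E n) (a : Fin m)
    (y : E m) : Matrix (Fin n) (Fin n) ℝ :=
  ∑ i, jac ψ y i a • conn γ i (ψ y)

/-- The pull-back `∂_a ψ^l ∂_b ψ^k R_{lk}` of the curvature along `ψ`. -/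
noncomputable def pullCurv (γ : E n → Matrix (Fin n) (Fin n) ℝ) (ψ : E m → E n) (a b : Fin m)
    (y : E m) : Matrix (Fin n) (Fin n) ℝ :=
  ∑ l, ∑ k, (jac ψ y l a * jac ψ y k b) • curv γ l k (ψ y)

variable {γ : E n → Matrix (Fin n) (Fin n) ℝ} {U : Set (E n)} {ψ : E m → E n} {y : E m}

theorem IsMetricOn.smooth_pullConn (hγ : IsMetricOn γ U) (hy : ψ y ∈ U)
    (hψ : ContDiffAt ℝ ∞ ψ y) (a : Fin m) : SmoothM (pullConn γ ψ a) y := by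
  intro k j
  simp only [pullConn, Matrix.sum_apply, Matrix.smul_apply, smul_eq_mul]
  exact ContDiffAt.sum fun i _ => (smooth_jac hψ i a).mul
    ((hγ.smooth_conn hy i).comp hψ k j)

theorem IsMetricOn.pdM_pullConn (hγ : IsMetricOn γ U) (hy : ψ y ∈ U)
    (hψ : ContDiffAt ℝ ∞ ψ y) (a b : Fin m) :
    pdM a (pullConn γ ψ b) y = ∑ i, pdM a (jac ψ) y i b • conn γ i (ψ y)
      + ∑ l, ∑ k, (jac ψ y l a * jac ψ y k b) • pdM l (conn γ k) (ψ y) := by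
  have h1 : pdM a (pullConn γ ψ b) y = ∑ i, (pdM a (jac ψ) y i b • conn γ i (ψ y)
      + jac ψ y i b • pdM a (fun z => conn γ i (ψ z)) y) := by
    ext k j
    simp only [pdM, pullConn, Matrix.sum_apply, Matrix.smul_apply, smul_eq_mul, Matrix.of_apply,
      Matrix.add_apply]
    have hd := fun i => differentiableAt_of_smooth (smooth_jac hψ i b)
    have hc := fun i => differentiableAt_of_smooth ((hγ.smooth_conn hy i).comp hψ k j)
    rw [pd_sum a fun i _ => (hd i).fun_mul (hc i)]
    exact Finset.sum_congr rfl fun i _ => pd_mul a (hd i) (hc i)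
  rw [h1, Finset.sum_add_distrib]
  congr 1
  rw [Finset.sum_comm]
  refine Finset.sum_congr rfl fun i _ => ?_
  rw [pdM_comp (hγ.smooth_conn hy i) hψ, Finset.smul_sum]
  exact Finset.sum_congr rfl fun l _ => by rw [smul_smul, mul_comm]

/-- Curvature is natural: the curvature of the pulled-back connection is the pulled-back curvature.
The second derivatives of ψ multiply Γ_i symmetrically in a, b and cancel. -/
theorem IsMetricOn.pullCurv_eq (hγ : IsMetricOn γ U) (hy : ψ y ∈ U)
    (hψ : ContDiffAt ℝ ∞ ψ y) (a b : Fin m) :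
    pullCurv γ ψ a b y = pdM a (pullConn γ ψ b) y - pdM b (pullConn γ ψ a) y
      + (pullConn γ ψ a y * pullConn γ ψ b y - pullConn γ ψ b y * pullConn γ ψ a y) := by
  have h1 : ∑ i, pdM b (jac ψ) y i a • conn γ i (ψ y)
      = ∑ i, pdM a (jac ψ) y i b • conn γ i (ψ y) :=
    Finset.sum_congr rfl fun i _ => by rw [pd_jac_comm hψ]
  have h2 : ∑ l, ∑ k, (jac ψ y l b * jac ψ y k a) • pdM l (conn γ k) (ψ y)
      = ∑ l, ∑ k, (jac ψ y l a * jac ψ y k b) • pdM k (conn γ l) (ψ y) := by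
    rw [Finset.sum_comm]
    exact Finset.sum_congr rfl fun l _ => Finset.sum_congr rfl fun k _ => by rw [mul_comm]
  have h3 : ∀ a b, pullConn γ ψ a y * pullConn γ ψ b y
      = ∑ l, ∑ k, (jac ψ y l a * jac ψ y k b) • (conn γ l (ψ y) * conn γ k (ψ y)) := by
    intro a b
    simp only [pullConn, Finset.sum_mul, Finset.mul_sum, Matrix.smul_mul, Matrix.mul_smul, smul_smul]
    rw [Finset.sum_comm]
    exact Finset.sum_congr rfl fun l _ => Finset.sum_congr rfl fun k _ => by rw [mul_comm]
  have h4 : pullConn γ ψ b y * pullConn γ ψ a y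
      = ∑ l, ∑ k, (jac ψ y l a * jac ψ y k b) • (conn γ k (ψ y) * conn γ l (ψ y)) := by
    rw [h3, Finset.sum_comm]
    exact Finset.sum_congr rfl fun l _ => Finset.sum_congr rfl fun k _ => by rw [mul_comm]
  rw [hγ.pdM_pullConn hy hψ, hγ.pdM_pullConn hy hψ, h1, h2, h3 a b, h4, pullCurv]
  simp only [curv, smul_add, smul_sub, Finset.sum_add_distrib, Finset.sum_sub_distrib]
  abel

theorem IsMetricOn.pdM_metric_comp (hγ : IsMetricOn γ U) (hy : ψ y ∈ U)
    (hψ : ContDiffAt ℝ ∞ ψ y) (a : Fin m) :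
    pdM a (fun z => γ (ψ z)) y
      = (pullConn γ ψ a y)ᵀ * γ (ψ y) + γ (ψ y) * pullConn γ ψ a y := by
  rw [pdM_comp (hγ.smooth _ hy) hψ]
  simp only [pullConn, hγ.pdM_eq hy, Matrix.transpose_sum, Finset.sum_mul, Finset.mul_sum,
    Matrix.transpose_smul, Matrix.smul_mul, Matrix.mul_smul, smul_add, Finset.sum_add_distrib]

/-- An immersed hypersurface, parametrized by `ψ` on `D`, orthogonal to the velocity `v` of a static
metric `γ`, with induced metric `h`. -/
structure IsOrthogonalSlice (γ : E (n + 1) → Matrix (Fin (n + 1)) (Fin (n + 1)) ℝ)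
    (v : E (n + 1) → Fin (n + 1) → ℝ) (U : Set (E (n + 1))) (ψ : E n → E (n + 1)) (D : Set (E n))
    (h : E n → Matrix (Fin n) (Fin n) ℝ) : Prop where
  isOpen : IsOpen D
  smooth : ∀ y ∈ D, ContDiffAt ℝ ∞ ψ y
  mapsTo : ∀ y ∈ D, ψ y ∈ U
  immersion : ∀ y ∈ D, ∀ c, jac ψ y *ᵥ c = 0 → c = 0
  orthogonal : ∀ y ∈ D, lower γ v (ψ y) ᵥ* jac ψ y = 0
  metric_eq : ∀ y ∈ D, h y = (jac ψ y)ᵀ * γ (ψ y) * jac ψ y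

namespace IsOrthogonalSlice

variable {γ : E (n + 1) → Matrix (Fin (n + 1)) (Fin (n + 1)) ℝ}
  {v : E (n + 1) → Fin (n + 1) → ℝ} {U : Set (E (n + 1))} {ψ : E n → E (n + 1)} {D : Set (E n)}
  {h : E n → Matrix (Fin n) (Fin n) ℝ} {y : E n}

theorem det_and_inv (hS : IsOrthogonalSlice γ v U ψ D h) (hγ : IsStaticOn γ v U) (hy : y ∈ D) :
    (h y).det ≠ 0 ∧ (γ (ψ y))⁻¹
      = jac ψ y * (h y)⁻¹ * (jac ψ y)ᵀ - vecMulVec (v (ψ y)) (v (ψ y)) := by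
  have hU := hS.mapsTo y hy
  rw [hS.metric_eq y hy]
  exact gram_det_ne_zero_and_inv_eq (hγ.symm _ hU) (hγ.det_ne_zero _ hU) (hγ.unit _ hU)
    (hS.orthogonal y hy) (hS.immersion y hy)

theorem isMetricOn (hS : IsOrthogonalSlice γ v U ψ D h) (hγ : IsStaticOn γ v U) :
    IsMetricOn h D where
  isOpen := hS.isOpen
  smooth y hy := by
    have h1 : SmoothM (fun z => (jac ψ z)ᵀ * γ (ψ z) * jac ψ z) y :=
      ((smooth_jac (hS.smooth y hy)).transpose.mul
        ((hγ.smooth _ (hS.mapsTo y hy)).comp (hS.smooth y hy))).mul (smooth_jac (hS.smooth y hy))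
    intro i j
    refine (h1 i j).congr_of_eventuallyEq ?_
    filter_upwards [hS.isOpen.mem_nhds hy] with z hz
    rw [hS.metric_eq z hz]
  symm y hy := by
    rw [hS.metric_eq y hy, Matrix.IsSymm, Matrix.transpose_mul, Matrix.transpose_mul,
      Matrix.transpose_transpose, hγ.symm _ (hS.mapsTo y hy), Matrix.mul_assoc]
  det_ne_zero y hy := (hS.det_and_inv hγ hy).1

/-- The Koszul formula for the induced connection. -/
theorem mul_conn (hS : IsOrthogonalSlice γ v U ψ D h) (hγ : IsStaticOn γ v U) (hy : y ∈ D)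
    (a : Fin n) : h y * conn h a y
      = (jac ψ y)ᵀ * γ (ψ y) * (pdM a (jac ψ) y + pullConn γ ψ a y * jac ψ y) := by
  have hU := hS.mapsTo y hy
  have hψ := hS.smooth y hy
  set P := jac ψ y with hP
  -- Column b of X a is ∇_a ∂_b ψ, so B a c b is g(∂_c ψ, ∇_a ∂_b ψ). Symmetry in a, b comes from
  -- commuting derivatives and vanishing torsion; with `hd` this is the input of the Koszul
  -- computation.
  set X : Fin n → Matrix (Fin (n + 1)) (Fin n) ℝ :=
    fun a => pdM a (jac ψ) y + pullConn γ ψ a y * P with hX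
  set B : Fin n → Matrix (Fin n) (Fin n) ℝ := fun a => Pᵀ * γ (ψ y) * X a with hB
  have hXs : ∀ a b k, X a k b = X b k a := by
    intro a b k
    simp only [hX, Matrix.add_apply, pd_jac_comm hψ a b k]
    congr 1
    simp only [pullConn, Matrix.mul_apply, Matrix.sum_apply, Matrix.smul_apply, smul_eq_mul, ← hP,
      Finset.sum_mul, conn, Matrix.of_apply]
    rw [Finset.sum_comm]
    refine Finset.sum_congr rfl fun j _ => Finset.sum_congr rfl fun i _ => ?_
    rw [hγ.christoffel_symm hU]
    ring
  have hBs : ∀ a b c, B a c b = B b c a := by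
    intro a b c
    simp only [hB, Matrix.mul_apply (M := Pᵀ * γ (ψ y)), hXs a b]
  have hd : ∀ a, pdM a h y = (B a)ᵀ + B a := by
    intro a
    have h0 : h =ᶠ[𝓝 y] fun z => (jac ψ z)ᵀ * γ (ψ z) * jac ψ z :=
      mem_of_superset (hS.isOpen.mem_nhds hy) hS.metric_eq
    rw [pdM_congr a h0, pdM_mul a ((smooth_jac hψ).transpose.mul ((hγ.smooth _ hU).comp hψ))
      (smooth_jac hψ), pdM_mul a (smooth_jac hψ).transpose ((hγ.smooth _ hU).comp hψ),
      hγ.pdM_metric_comp hU hψ, pdM_transpose]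
    simp only [hB, hX, Matrix.transpose_mul, Matrix.transpose_add, Matrix.transpose_transpose,
      (hγ.symm _ hU).eq, ← hP, Matrix.mul_add, Matrix.add_mul, Matrix.mul_assoc]
    abel
  have hd' : ∀ a b c, pd a (fun z => h z b c) y = B a c b + B a b c := fun a b c =>
    congrFun (congrFun (hd a) b) c
  ext c b
  rw [(hS.isMetricOn hγ).mul_conn_apply hy, hd', hd', hd', hBs b a c, hBs c b a, hBs c a b]
  change _ = B a c b
  ring

/-- The slice is totally geodesic: `∂_a ∂_b ψ^k + Γ^k_{ij} ∂_a ψ^i ∂_b ψ^j = Γ^c_{ab} ∂_c ψ^k`. -/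
theorem pdM_jac (hS : IsOrthogonalSlice γ v U ψ D h) (hγ : IsStaticOn γ v U) (hy : y ∈ D)
    (a : Fin n) :
    pdM a (jac ψ) y = jac ψ y * conn h a y - pullConn γ ψ a y * jac ψ y := by
  have hU := hS.mapsTo y hy
  have hψ := hS.smooth y hy
  have hω := hγ.smooth_lower hU (hγ.smooth_vel _ hU)
  set X := pdM a (jac ψ) y + pullConn γ ψ a y * jac ψ y with hX
  -- The derivative of the orthogonality relation along the slice. The term u_i a_j of ∇u drops out
  -- since ∂_a ψ is orthogonal to u, so ∇_a ∂_b ψ has no normal component.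
  have h1 : lower γ v (ψ y) ᵥ* X = 0 := by
    have h0 : pdV a (fun z => lower γ v (ψ z) ᵥ* jac ψ z) y = 0 := by
      rw [pdV_congr a (w := fun _ => 0)
        (mem_of_superset (hS.isOpen.mem_nhds hy) hS.orthogonal)]
      ext i
      exact pd_const a 0 y
    rw [pdV_vecMul a (hω.comp hψ) (smooth_jac hψ), pdV_comp hω hψ] at h0
    have h2 : ∑ i, jac ψ y i a • pdV i (lower γ v) (ψ y)
        = lower γ v (ψ y) ᵥ* pullConn γ ψ a y := by
      have h3 : ∑ i, jac ψ y i a • lower γ v (ψ y) i • accel γ v (ψ y) = 0 := by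
        have := congrFun (hS.orthogonal y hy) a
        simp only [Matrix.vecMul, dotProduct, Pi.zero_apply] at this
        simp only [smul_smul, ← Finset.sum_smul, mul_comm (jac ψ y _ a), this, zero_smul]
      simp only [hγ.pdV_lower hU, smul_sub, Finset.sum_sub_distrib, h3, sub_zero, pullConn,
        Matrix.vecMul_sum, Matrix.vecMul_smul]
    rw [h2, Matrix.vecMul_vecMul, ← Matrix.vecMul_add] at h0
    rw [hX, add_comm (pdM a (jac ψ) y)]
    exact h0
  -- With the inverse metric split into tangential and normal parts, only the tangential part of X
  -- survives, and the Koszul formula identifies it.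
  have h2 : X = jac ψ y * conn h a y := by
    have h3 : (γ (ψ y))⁻¹ * (γ (ψ y) * X) = X := by
      rw [← Matrix.mul_assoc, hγ.inv_mul hU, Matrix.one_mul]
    rw [← h3, (hS.det_and_inv hγ hy).2, Matrix.sub_mul, Matrix.vecMulVec_mul,
      ← Matrix.vecMul_vecMul, ← hγ.lower_eq_vecMul hU, h1]
    have h4 : jac ψ y * (h y)⁻¹ * (jac ψ y)ᵀ * (γ (ψ y) * X)
        = jac ψ y * ((h y)⁻¹ * ((jac ψ y)ᵀ * γ (ψ y) * X)) := by
      simp only [Matrix.mul_assoc]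
    rw [h4, ← hS.mul_conn hγ hy, ← Matrix.mul_assoc (h y)⁻¹, (hS.isMetricOn hγ).inv_mul hy,
      Matrix.one_mul]
    ext i j
    simp [vecMulVec_apply]
  rw [← h2, hX]
  abel

/-- The Gauss equation for a totally geodesic slice. -/
theorem pullCurv_mul_jac (hS : IsOrthogonalSlice γ v U ψ D h) (hγ : IsStaticOn γ v U)
    (hy : y ∈ D) (a b : Fin n) :
    pullCurv γ ψ a b y * jac ψ y = jac ψ y * curv h a b y := by
  have hU := hS.mapsTo y hy
  have hψ := hS.smooth y hy
  have hh := hS.isMetricOn hγ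
  -- The Gauss equation is the integrability condition of the linear system `pdM_jac` for the
  -- Jacobian.
  have key : ∀ a b, pdM a (pdM b (jac ψ)) y
      = (jac ψ y * conn h a y - pullConn γ ψ a y * jac ψ y) * conn h b y
        + jac ψ y * pdM a (conn h b) y
        - (pdM a (pullConn γ ψ b) y * jac ψ y
          + pullConn γ ψ b y * (jac ψ y * conn h a y - pullConn γ ψ a y * jac ψ y)) := by
    intro a b
    rw [pdM_congr a (N := fun z => jac ψ z * conn h b z - pullConn γ ψ b z * jac ψ z)
        (mem_of_superset (hS.isOpen.mem_nhds hy) fun z hz => hS.pdM_jac hγ hz b),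
      pdM_sub a ((smooth_jac hψ).mul (hh.smooth_conn hy b))
        ((hγ.smooth_pullConn hU hψ b).mul (smooth_jac hψ)),
      pdM_mul a (smooth_jac hψ) (hh.smooth_conn hy b),
      pdM_mul a (hγ.smooth_pullConn hU hψ b) (smooth_jac hψ), hS.pdM_jac hγ hy a]
  have h0 := pdM_comm (smooth_jac hψ) a b
  rw [key, key] at h0
  rw [hγ.pullCurv_eq hU hψ, curv]
  simp only [Matrix.mul_add, Matrix.add_mul, Matrix.mul_sub, Matrix.sub_mul,
    ← Matrix.mul_assoc] at h0 ⊢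
  rw [← sub_eq_zero] at h0 ⊢
  rw [← neg_eq_zero]
  refine Eq.trans ?_ h0
  abel

/-- P h⁻¹ Pᵀ = g⁻¹ + u ⊗ u is the inverse metric of the tangent space of the slice. By the Gauss
equation, tracing the slice curvature with h⁻¹ amounts to tracing the ambient curvature with it. -/
theorem scalarCurv_eq_sum (hS : IsOrthogonalSlice γ v U ψ D h) (hγ : IsStaticOn γ v U)
    (hy : y ∈ D) :
    scalarCurv h y = ∑ l, ∑ k, (((γ (ψ y))⁻¹ + vecMulVec (v (ψ y)) (v (ψ y)))
      * (γ (ψ y) * curv γ l k (ψ y))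
      * ((γ (ψ y))⁻¹ + vecMulVec (v (ψ y)) (v (ψ y)))) l k := by
  have hh := hS.isMetricOn hγ
  set P := jac ψ y with hP
  have hN : (γ (ψ y))⁻¹ + vecMulVec (v (ψ y)) (v (ψ y)) = P * (h y)⁻¹ * Pᵀ := by
    rw [(hS.det_and_inv hγ hy).2]
    abel
  set Y : Fin (n + 1) → Fin (n + 1) → Matrix (Fin n) (Fin n) ℝ := fun l k =>
    (h y)⁻¹ * Pᵀ * (γ (ψ y) * curv γ l k (ψ y)) * P * (h y)⁻¹ with hY
  have h1 : ∀ a b, curv h a b y * (h y)⁻¹ = ∑ l, ∑ k, (P l a * P k b) • Y l k := by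
    intro a b
    have h2 : curv h a b y
        = (h y)⁻¹ * Pᵀ * γ (ψ y) * pullCurv γ ψ a b y * P := by
      rw [Matrix.mul_assoc, hS.pullCurv_mul_jac hγ hy, ← Matrix.mul_assoc, Matrix.mul_assoc (h y)⁻¹,
        Matrix.mul_assoc (h y)⁻¹, ← hS.metric_eq y hy, hh.inv_mul hy, Matrix.one_mul]
    rw [h2, pullCurv]
    simp only [hY, Matrix.sum_mul, Matrix.mul_sum, Matrix.smul_mul, Matrix.mul_smul, ← hP,
      Matrix.mul_assoc]
  have h3 : scalarCurv h y = ∑ b, ∑ a, (curv h a b y * (h y)⁻¹) a b := by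
    simp only [scalarCurv, ricci, riemannUp_eq_curv, Matrix.mul_apply, Finset.mul_sum]
    rw [Finset.sum_comm]
    refine Finset.sum_congr rfl fun b _ => ?_
    rw [Finset.sum_comm]
    exact Finset.sum_congr rfl fun a _ => Finset.sum_congr rfl fun c _ => mul_comm _ _
  have h4 : ∀ l k, (P * Y l k * Pᵀ) l k = ∑ b, ∑ a, (P l a * P k b) * Y l k a b := by
    intro l k
    simp only [Matrix.mul_apply, Matrix.transpose_apply, Finset.sum_mul]
    exact Finset.sum_congr rfl fun b _ => Finset.sum_congr rfl fun a _ => by ring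
  have h5 : ∀ l k, P * (h y)⁻¹ * Pᵀ * (γ (ψ y) * curv γ l k (ψ y)) * (P * (h y)⁻¹ * Pᵀ)
      = P * Y l k * Pᵀ := fun l k => by
    simp only [hY, Matrix.mul_assoc]
  simp only [hN, h5, h4, h3, h1, Matrix.sum_apply, Matrix.smul_apply, smul_eq_mul]
  calc _ = ∑ b, ∑ l, ∑ a, ∑ k, P l a * P k b * Y l k a b :=
        Finset.sum_congr rfl fun b _ => Finset.sum_comm
    _ = ∑ l, ∑ b, ∑ a, ∑ k, P l a * P k b * Y l k a b := Finset.sum_comm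
    _ = ∑ l, ∑ b, ∑ k, ∑ a, P l a * P k b * Y l k a b :=
        Finset.sum_congr rfl fun l _ => Finset.sum_congr rfl fun b _ => Finset.sum_comm
    _ = _ := Finset.sum_congr rfl fun l _ => Finset.sum_comm

/-- The scalar curvature of a slice orthogonal to the velocity. -/
theorem scalarCurv_eq (hS : IsOrthogonalSlice γ v U ψ D h) (hγ : IsStaticOn γ v U)
    (hy : y ∈ D) : scalarCurv h y = spatialScalar γ v (ψ y) := by
  have hU := hS.mapsTo y hy
  rw [hS.scalarCurv_eq_sum hγ hy]
  set x := ψ y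
  set w := v x
  set ρ := w ⬝ᵥ (Matrix.of (ricci γ x) *ᵥ w) with hρ
  set S : Fin (n + 1) → Fin (n + 1) → Matrix (Fin (n + 1)) (Fin (n + 1)) ℝ :=
    fun l k => γ x * curv γ l k x with hSdef
  have hSt : ∀ l k, (S l k)ᵀ = S k l := by
    intro l k
    ext i j
    simp only [Matrix.transpose_apply, hSdef, ← riemann_eq_curv]
    rw [hγ.riemann_antisymm_left hU, IsMetricOn.riemann_antisymm_right, neg_neg]
  have hgS : ∀ l k, (γ x)⁻¹ * S l k = curv γ l k x := fun l k => by
    rw [hSdef, ← Matrix.mul_assoc, hγ.inv_mul hU, Matrix.one_mul]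
  have hric : ∀ j k, ∑ l, curv γ l k x l j = ricci γ x j k := fun j k => by
    simp only [ricci, riemannUp_eq_curv]
  have hsum : ∀ f : Fin (n + 1) → Fin (n + 1) → Fin (n + 1) → ℝ,
      ∑ l, ∑ k, ∑ j, f l k j = ∑ j, ∑ k, ∑ l, f l k j := fun f => by
    rw [Finset.sum_comm]
    simp only [Finset.sum_comm (f := fun l j => f l _ j)]
    exact Finset.sum_comm
  -- Expanding both factors g⁻¹ + u ⊗ u gives four traces: R, Ric(u,u) twice, and a term that
  -- vanishes because S l k is antisymmetric.
  have t1 : ∑ l, ∑ k, ((γ x)⁻¹ * S l k * (γ x)⁻¹) l k = scalarCurv γ x := by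
    simp only [hgS, Matrix.mul_apply, scalarCurv, ← hric, Finset.mul_sum]
    rw [hsum]
    exact Finset.sum_congr rfl fun j _ => Finset.sum_congr rfl fun k _ =>
      Finset.sum_congr rfl fun l _ => mul_comm _ _
  have t2 : ∑ l, ∑ k, ((γ x)⁻¹ * S l k * vecMulVec w w) l k = ρ := by
    simp only [hgS, Matrix.mul_apply, hρ, dotProduct, Matrix.mulVec, Matrix.of_apply, ← hric,
      Finset.mul_sum, Finset.sum_mul, vecMulVec_apply]
    rw [hsum]
    exact Finset.sum_congr rfl fun j _ => Finset.sum_congr rfl fun k _ =>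
      Finset.sum_congr rfl fun l _ => by ring
  have t3 : ∑ l, ∑ k, (vecMulVec w w * S l k * (γ x)⁻¹) l k = ρ := by
    rw [← t2, Finset.sum_comm]
    refine Finset.sum_congr rfl fun k _ => Finset.sum_congr rfl fun l _ => ?_
    rw [← Matrix.transpose_apply (_ * _) k l, Matrix.transpose_mul, Matrix.transpose_mul, hSt,
      hγ.inv_isSymm hU, Matrix.transpose_vecMulVec]
    exact congrFun (congrFun (Matrix.mul_assoc _ _ _).symm k) l
  have t4 : ∑ l, ∑ k, (vecMulVec w w * S l k * vecMulVec w w) l k = 0 := by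
    refine Finset.sum_eq_zero fun l _ => Finset.sum_eq_zero fun k _ => ?_
    have h2 : S l k = -S k l := by
      simp only [hSdef]
      rw [curv_antisymm x l k, Matrix.mul_neg]
    have h3 : (w ᵥ* S l k) ⬝ᵥ w = 0 := by
      have h4 : (w ᵥ* S l k) ⬝ᵥ w = -((w ᵥ* S l k) ⬝ᵥ w) := by
        conv_lhs => rw [← Matrix.dotProduct_mulVec, ← Matrix.vecMul_transpose, hSt,
          dotProduct_comm, ← neg_neg (S k l), ← h2, Matrix.vecMul_neg, neg_dotProduct]
      linarith
    rw [Matrix.vecMulVec_mul, Matrix.vecMulVec_mul_vecMulVec, h3]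
    simp [vecMulVec_apply]
  simp only [Matrix.mul_add, Matrix.add_mul, Matrix.add_apply, Finset.sum_add_distrib]
  have h1 : Matrix.of (einstein γ x)
      = Matrix.of (ricci γ x) - (1 / 2 * scalarCurv γ x) • γ x := rfl
  have h2 : w ⬝ᵥ (γ x *ᵥ w) = -1 := by
    rw [dotProduct_comm]
    exact hγ.unit x hU
  rw [t1, t2, t3, t4, spatialScalar, h1, Matrix.sub_mulVec, Matrix.smul_mulVec, dotProduct_sub,
    dotProduct_smul, h2, ← hρ, smul_eq_mul]
  ring

end IsOrthogonalSlice

end Gauss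

end StaticCKG

namespace StaticCKG

open Matrix Filter Topology

/-! ### Level sets and closed one-forms -/

section Level

variable {n : ℕ}

/-- The derivative of a function with the `i`-th coordinate replaced by a functional `L` with
`L e_i ≠ 0` is invertible. -/
theorem exists_equiv_replace_coordinate (L : E n →L[ℝ] ℝ) (i : Fin n)
    (hL : L (EuclideanSpace.single i 1) ≠ 0) :
    ∃ A : E n ≃L[ℝ] E n, (A : E n →L[ℝ] E n) = ContinuousLinearMap.id ℝ (E n)
      + (L - EuclideanSpace.proj i).smulRight (EuclideanSpace.single i (1 : ℝ) : E n) := by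
  set T : E n →L[ℝ] E n := ContinuousLinearMap.id ℝ (E n)
      + (L - EuclideanSpace.proj i).smulRight (EuclideanSpace.single i (1 : ℝ) : E n) with hT
  have hinj : Function.Injective (T : E n →ₗ[ℝ] E n) := by
    rw [← LinearMap.ker_eq_bot, LinearMap.ker_eq_bot']
    intro c hc
    have hTc : ∀ j, c j + (L c - c i) * (EuclideanSpace.single i (1 : ℝ) : E n) j = 0 :=
      fun j => congrArg (fun w : E n => w j) hc
    have h1 : ∀ j, j ≠ i → c j = 0 := fun j hj => by
      simpa [hj] using hTc j
    have h2 : L c = 0 := by simpa using hTc i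
    have h3 : c = c i • (EuclideanSpace.single i 1 : E n) := by
      ext j
      by_cases hj : j = i
      · subst hj; simp
      · simp [hj, h1 j hj]
    rw [h3, map_smul, smul_eq_mul, mul_eq_zero] at h2
    rw [h3, h2.resolve_right hL, zero_smul]
  refine ⟨(LinearEquiv.ofInjectiveEndo (T : E n →ₗ[ℝ] E n) hinj).toContinuousLinearEquiv, ?_⟩
  ext c
  rfl

theorem fderiv_coord {m : ℕ} {ψ : E m → E n} {y : E m} (hψ : DifferentiableAt ℝ ψ y) (i : Fin n)
    (c : E m) : fderiv ℝ (fun z => ψ z i) y c = fderiv ℝ ψ y c i := by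
  have h2 : HasFDerivAt (fun z => ψ z i)
      ((EuclideanSpace.proj i : E n →L[ℝ] ℝ).comp (fderiv ℝ ψ y)) y :=
    (EuclideanSpace.proj i : E n →L[ℝ] ℝ).hasFDerivAt.comp y hψ.hasFDerivAt
  rw [h2.fderiv]
  rfl

/-- A regular level set of a smooth function has smooth local parametrizations. -/
theorem exists_level_parametrization {f : E (n + 1) → ℝ} {B : Set (E (n + 1))} (hB : IsOpen B)
    (hf : ContDiffOn ℝ ∞ f B) {x₀ : E (n + 1)} (hx₀ : x₀ ∈ B) (hdf : fderiv ℝ f x₀ ≠ 0) :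
    ∃ (D : Set (E n)) (ψ : E n → E (n + 1)), IsOpen D ∧ (∃ y ∈ D, ψ y = x₀) ∧
      ∀ y ∈ D, ContDiffAt ℝ ∞ ψ y ∧ ψ y ∈ B ∧ Function.Injective (fderiv ℝ ψ y) ∧
        ∀ c, fderiv ℝ f (ψ y) (fderiv ℝ ψ y c) = 0 := by
  obtain ⟨i, hi⟩ : ∃ i, fderiv ℝ f x₀ (EuclideanSpace.single i 1) ≠ 0 := by
    by_contra! h
    refine hdf (ContinuousLinearMap.ext fun c => ?_)
    rw [fderiv_eq_sum_pd]
    exact Finset.sum_eq_zero fun i _ => by rw [pd, h i, mul_zero]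
  set V : Set (E (n + 1)) :=
    B ∩ (fun x => fderiv ℝ f x (EuclideanSpace.single i 1)) ⁻¹' {0}ᶜ with hV
  have hVo : IsOpen V := by
    refine ContinuousOn.isOpen_inter_preimage ?_ hB isOpen_compl_singleton
    exact (hf.continuousOn_fderiv_of_isOpen hB (by simp)).clm_apply continuousOn_const
  have hfB : ∀ x ∈ B, ContDiffAt ℝ ∞ f x := fun x hx => hf.contDiffAt (hB.mem_nhds hx)
  -- F replaces the i-th coordinate by f. Its local inverse straightens the level sets of f, and ψ
  -- is that inverse on the slice where coordinate i equals f x₀.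
  set F : E (n + 1) → E (n + 1) :=
    fun x => x + (f x - x i) • (EuclideanSpace.single i (1 : ℝ) : E (n + 1)) with hF
  have hFs : ∀ x ∈ B, ContDiffAt ℝ ∞ F x := fun x hx =>
    contDiffAt_id.add (((hfB x hx).sub (contDiffAt_euclidean.1 contDiffAt_id i)).smul
      contDiffAt_const)
  have hFd : ∀ x ∈ V, ∃ A : E (n + 1) ≃L[ℝ] E (n + 1),
      HasFDerivAt F (A : E (n + 1) →L[ℝ] E (n + 1)) x := by
    intro x hx
    obtain ⟨A, hA⟩ := exists_equiv_replace_coordinate (fderiv ℝ f x) i hx.2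
    refine ⟨A, ?_⟩
    rw [hA]
    exact (hasFDerivAt_id x).add
      (((differentiableAt_of_smooth (hfB x hx.1)).hasFDerivAt.sub
        (EuclideanSpace.proj i : E (n + 1) →L[ℝ] ℝ).hasFDerivAt).smul_const _)
  obtain ⟨A₀, hA₀⟩ := hFd x₀ ⟨hx₀, hi⟩
  set Φ := (hFs x₀ hx₀).toOpenPartialHomeomorph F hA₀ (by simp) with hΦ
  have hΦF : ∀ x, Φ x = F x := fun x => rfl
  have hx₀Φ : x₀ ∈ Φ.source :=
    ContDiffAt.mem_toOpenPartialHomeomorph_source (hFs x₀ hx₀) hA₀ (by simp)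
  set ι : E n → E (n + 1) := fun z => WithLp.toLp 2 (i.insertNth (f x₀) z) with hι
  have hιi : ∀ z, ι z i = f x₀ := fun z => by simp [hι]
  have hιj : ∀ z j, ι z (i.succAbove j) = z j := fun z j => by simp [hι]
  have hιs : ContDiff ℝ ∞ ι := by
    rw [contDiff_euclidean]
    intro j
    rcases i.eq_self_or_eq_succAbove j with rfl | ⟨k, rfl⟩
    · simp only [hιi]; exact contDiff_const
    · simp only [hιj]; exact contDiff_euclidean.1 contDiff_id k
  set ψ : E n → E (n + 1) := fun z => Φ.symm (ι z) with hψ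
  -- Restricting to preimages in V keeps ∂_i f ≠ 0 at every point, so that the inverse is smooth on
  -- all of D.
  set D : Set (E n) := ι ⁻¹' (Φ.target ∩ Φ.symm ⁻¹' V) with hD
  have hDo : IsOpen D := (Φ.symm.isOpen_inter_preimage hVo).preimage hιs.continuous
  have hFψ : ∀ z ∈ D, F (ψ z) = ι z := fun z hz => Φ.right_inv hz.1
  have hψs : ∀ z ∈ D, ContDiffAt ℝ ∞ ψ z := by
    intro z hz
    obtain ⟨A, hA⟩ := hFd _ hz.2
    exact (Φ.contDiffAt_symm hz.1 hA (hFs _ hz.2.1)).comp z hιs.contDiffAt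
  have hψj : ∀ z ∈ D, ∀ j, ψ z (i.succAbove j) = z j := by
    intro z hz j
    have := congrArg (fun w : E (n + 1) => w (i.succAbove j)) (hFψ z hz)
    simpa [hF, hιj, Fin.succAbove_ne] using this
  have hfψ : ∀ z ∈ D, f (ψ z) = f x₀ := by
    intro z hz
    have := congrArg (fun w : E (n + 1) => w i) (hFψ z hz)
    simpa [hF, hιi] using this
  have hy₀ : ι (WithLp.toLp 2 (i.removeNth x₀)) = Φ x₀ := by
    ext j
    rcases i.eq_self_or_eq_succAbove j with rfl | ⟨k, rfl⟩
    · simp [hιi, hΦF, hF]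
    · simp [hιj, hΦF, hF, Fin.succAbove_ne, Fin.removeNth]
  refine ⟨D, ψ, hDo, ⟨WithLp.toLp 2 (i.removeNth x₀), ?_, ?_⟩, fun y hy => ⟨hψs y hy, hy.2.1, ?_, ?_⟩⟩
  · simp only [hD, Set.mem_preimage, hy₀, Set.mem_inter_iff, Φ.left_inv hx₀Φ]
    exact ⟨Φ.map_source hx₀Φ, hx₀, hi⟩
  · simp only [hψ, hy₀, Φ.left_inv hx₀Φ]
  · rw [injective_iff_map_eq_zero]
    intro c hc
    ext j
    -- The coordinates of ψ other than the i-th are the parameters themselves, whence the immersion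
    -- property.
    have h1 : (fun z => ψ z (i.succAbove j)) =ᶠ[𝓝 y] fun z => z j :=
      mem_of_superset (hDo.mem_nhds hy) fun z hz => hψj z hz j
    have h2 := fderiv_coord (differentiableAt_of_smooth (hψs y hy)) (i.succAbove j) c
    rw [h1.fderiv_eq, hc, fderiv_coord (ψ := fun z => z) differentiableAt_id] at h2
    simpa using h2
  · intro c
    have h1 : (fun z => f (ψ z)) =ᶠ[𝓝 y] fun _ => f x₀ :=
      mem_of_superset (hDo.mem_nhds hy) hfψ
    have h2 := fderiv_comp (g := f) (f := ψ) y (differentiableAt_of_smooth (hfB _ hy.2.1))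
      (differentiableAt_of_smooth (hψs y hy))
    have h3 := h1.fderiv_eq (𝕜 := ℝ)
    rw [fderiv_fun_const] at h3
    exact DFunLike.congr_fun (h2.symm.trans h3) c

/-- The Poincaré lemma for one-forms in components. -/
theorem exists_potential {α : E n → Fin n → ℝ} {U : Set (E n)} (hU : IsOpen U)
    (hα : ∀ x ∈ U, SmoothV α x)
    (hsymm : ∀ x ∈ U, ∀ i j, pd i (fun y => α y j) x = pd j (fun y => α y i) x)
    {x₀ : E n} (hx₀ : x₀ ∈ U) :
    ∃ (B : Set (E n)) (f : E n → ℝ), IsOpen B ∧ x₀ ∈ B ∧ B ⊆ U ∧ ContDiffOn ℝ ∞ f B ∧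
      ∀ x ∈ B, ∀ c, fderiv ℝ f x c = α x ⬝ᵥ c := by
  obtain ⟨ε, hε, hεU⟩ := Metric.isOpen_iff.1 hU x₀ hx₀
  -- The one-form as a map into the dual space: closedness says that its derivative is a symmetric
  -- bilinear form, and a ball is convex.
  set Ω : E n → E n →L[ℝ] ℝ :=
    fun x => ∑ j, α x j • (EuclideanSpace.proj j : E n →L[ℝ] ℝ) with hΩ
  have hΩc : ∀ x c, Ω x c = α x ⬝ᵥ c := fun x c => by
    simp [hΩ, dotProduct, _root_.sum_apply]
  have hΩs : ∀ x ∈ U, ContDiffAt ℝ ∞ Ω x := fun x hx =>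
    ContDiffAt.sum fun j _ => (hα x hx j).smul contDiffAt_const
  have hΩd : ∀ x ∈ U, ∀ b c : E n, fderiv ℝ Ω x b c
      = ∑ j, ∑ i, b i * c j * pd i (fun y => α y j) x := by
    intro x hx b c
    have h1 : HasFDerivAt (fun y => Ω y c) _ x :=
      (differentiableAt_of_smooth (hΩs x hx)).hasFDerivAt.clm_apply (hasFDerivAt_const c x)
    have h2 : fderiv ℝ (fun y => Ω y c) x b = fderiv ℝ Ω x b c := by
      rw [h1.fderiv]
      simp
    rw [← h2, fderiv_eq_sum_pd, Finset.sum_comm]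
    refine Finset.sum_congr rfl fun i _ => ?_
    have hd := fun j => differentiableAt_of_smooth (hα x hx j)
    simp only [hΩc, dotProduct]
    rw [pd_sum i fun j _ => (hd j).mul_const _, Finset.mul_sum]
    refine Finset.sum_congr rfl fun j _ => ?_
    rw [pd_mul i (hd j) (differentiableAt_const _), pd_const]
    ring
  obtain ⟨f, hf⟩ := (convex_ball x₀ ε).exists_forall_hasFDerivAt_of_fderiv_symmetric
    Metric.isOpen_ball
    (fun x hx => (differentiableAt_of_smooth (hΩs x (hεU hx))).differentiableWithinAt)
    (fun x hx b c => by
      rw [hΩd x (hεU hx), hΩd x (hεU hx), Finset.sum_comm]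
      refine Finset.sum_congr rfl fun i _ => Finset.sum_congr rfl fun j _ => ?_
      rw [hsymm x (hεU hx) i j]
      ring)
  refine ⟨Metric.ball x₀ ε, f, Metric.isOpen_ball, Metric.mem_ball_self hε, hεU, ?_,
    fun x hx c => by rw [(hf x hx).fderiv, hΩc]⟩
  rw [contDiffOn_infty_iff_fderiv_of_isOpen Metric.isOpen_ball]
  refine ⟨fun x hx => (hf x hx).differentiableAt.differentiableWithinAt, fun x hx => ?_⟩
  exact ((hΩs x (hεU hx)).contDiffWithinAt).congr (fun z hz => (hf z hz).fderiv) (hf x hx).fderiv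

end Level

end StaticCKG

namespace StaticCKG

open Matrix Filter Topology

/-! ### Static spacetimes in charts -/

section Charts

variable {M : Type*} [TopologicalSpace M] [ChartedSpace (E 4) M]
  {g : LorentzMetric M} {u : ∀ p : M, TangentSpace 𝓘(ℝ, E 4) p}
  {e : OpenPartialHomeomorph M (E 4)}

/-- The differential of a chart, with values in the coordinate space. -/
noncomputable def chartDeriv (e : OpenPartialHomeomorph M (E 4)) (p : M)
    (a : TangentSpace 𝓘(ℝ, E 4) p) : E 4 :=
  mfderiv 𝓘(ℝ, E 4) 𝓘(ℝ, E 4) e p a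

theorem vecComp_eq (v : ∀ p : M, TangentSpace 𝓘(ℝ, E 4) p) (x : E 4) :
    vecComp v e x = chartDeriv e (e.symm x) (v (e.symm x)) := rfl

theorem vecComp_chart (v : ∀ p : M, TangentSpace 𝓘(ℝ, E 4) p) {p : M} (hp : p ∈ e.source) :
    vecComp v e (e p) = chartDeriv e p (v p) := by
  rw [vecComp_eq, e.left_inv hp]

theorem mdifferentiable_of_mem_charts (he : e ∈ Charts M) :
    e.MDifferentiable 𝓘(ℝ, E 4) 𝓘(ℝ, E 4) :=
  ⟨(contMDiffOn_of_mem_maximalAtlas he).mdifferentiableOn (by simp),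
    (contMDiffOn_symm_of_mem_maximalAtlas he).mdifferentiableOn (by simp)⟩

theorem mfderiv_symm_chartDeriv (he : e ∈ Charts M) {x : E 4} (hx : x ∈ e.target)
    (a : TangentSpace 𝓘(ℝ, E 4) (e.symm x)) :
    mfderiv 𝓘(ℝ, E 4) 𝓘(ℝ, E 4) e.symm x (chartDeriv e (e.symm x) a) = a := by
  have h := (mdifferentiable_of_mem_charts he).symm_comp_deriv (e.map_target hx)
  have h2 := DFunLike.congr_fun h a
  rw [e.right_inv hx] at h2
  exact h2

/-- The metric in terms of its components in a chart. -/
theorem form_eq_of_mem_target (g : LorentzMetric M) (he : e ∈ Charts M) {x : E 4}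
    (hx : x ∈ e.target) (a b : TangentSpace 𝓘(ℝ, E 4) (e.symm x)) :
    g.form (e.symm x) a b
      = (chartDeriv e (e.symm x) a).ofLp ⬝ᵥ (g.inChart e x *ᵥ (chartDeriv e (e.symm x) b).ofLp) := by
  set D : E 4 →ₗ[ℝ] TangentSpace 𝓘(ℝ, E 4) (e.symm x) :=
    (mfderiv 𝓘(ℝ, E 4) 𝓘(ℝ, E 4) e.symm x).toLinearMap with hD
  have key : ∀ c d : E 4, g.form (e.symm x) (D c) (D d)
      = c.ofLp ⬝ᵥ (g.inChart e x *ᵥ d.ofLp) := by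
    intro c d
    have hG : ∀ i j, g.inChart e x i j
        = g.form (e.symm x) (D (EuclideanSpace.single i 1)) (D (EuclideanSpace.single j 1)) :=
      fun i j => rfl
    conv_lhs => rw [euclidean_eq_sum_single c, euclidean_eq_sum_single d]
    simp only [map_sum, map_smul, LinearMap.sum_apply, LinearMap.smul_apply, smul_eq_mul,
      dotProduct, Matrix.mulVec, hG, Finset.mul_sum]
    rw [Finset.sum_comm]
    exact Finset.sum_congr rfl fun i _ => Finset.sum_congr rfl fun j _ => by ring
  rw [← key]
  congr 1
  · congr 1
    exact (mfderiv_symm_chartDeriv he hx a).symm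
  · exact (mfderiv_symm_chartDeriv he hx b).symm

theorem form_eq (g : LorentzMetric M) (he : e ∈ Charts M) {p : M} (hp : p ∈ e.source)
    (a b : TangentSpace 𝓘(ℝ, E 4) p) :
    g.form p a b
      = (chartDeriv e p a).ofLp ⬝ᵥ (g.inChart e (e p) *ᵥ (chartDeriv e p b).ofLp) := by
  obtain ⟨x, hx, rfl⟩ : ∃ x ∈ e.target, e.symm x = p := ⟨e p, e.map_source hp, e.left_inv hp⟩
  rw [e.right_inv hx]
  exact form_eq_of_mem_target g he hx a b

theorem chartDeriv_surjective (he : e ∈ Charts M) {p : M} (hp : p ∈ e.source) :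
    Function.Surjective (chartDeriv e p) :=
  (mdifferentiable_of_mem_charts he).mfderiv_surjective hp

theorem inChart_isMetricOn (g : LorentzMetric M) (he : e ∈ Charts M) :
    IsMetricOn (g.inChart e) e.target where
  isOpen := e.open_target
  smooth x hx i j := (g.smooth e he i j).contDiffAt (e.open_target.mem_nhds hx)
  symm x hx := by
    ext i j
    exact g.symm _ _ _
  det_ne_zero x hx := by
    intro h0
    obtain ⟨c, hc0, hc⟩ := Matrix.exists_mulVec_eq_zero_iff.2 h0
    obtain ⟨w, hw⟩ := chartDeriv_surjective he (e.map_target hx) (WithLp.toLp 2 c)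
    obtain ⟨b, hb⟩ := g.signature (e.symm x)
    -- A kernel vector of the component matrix is orthogonal to all vectors; pairing with the
    -- Lorentz-orthonormal basis annihilates each coordinate.
    have h1 : ∀ a, g.form (e.symm x) a w = 0 := fun a => by
      rw [form_eq_of_mem_target g he hx, hw]
      simp [hc]
    have h2 : w = 0 := by
      have h3 : b.repr w = 0 := by
        ext i
        have h4 := h1 (b i)
        rw [← b.sum_repr w] at h4
        simp only [map_sum, map_smul, smul_eq_mul, hb] at h4
        rw [Finset.sum_eq_single i] at h4
        · fin_cases i <;> simpa using h4
        · intro j _ hj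
          simp [Matrix.diagonal_apply_ne' _ hj]
        · simp
      simpa using h3
    refine hc0 ?_
    have h5 : chartDeriv e (e.symm x) w = 0 := by
      rw [h2]
      exact map_zero (mfderiv 𝓘(ℝ, E 4) 𝓘(ℝ, E 4) e (e.symm x))
    rw [h5] at hw
    exact (congrArg WithLp.ofLp hw).symm

theorem IsStatic.isStaticOn (hu : IsStatic g u) (he : e ∈ Charts M) :
    IsStaticOn (g.inChart e) (vecComp u e) e.target where
  toIsMetricOn := inChart_isMetricOn g he
  smooth_vel x hx i := (hu.smooth e he i).contDiffAt (e.open_target.mem_nhds hx)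
  unit x hx := by
    rw [lower_eq_mulVec, dotProduct_comm, vecComp_eq, ← form_eq_of_mem_target g he hx, hu.unit]
  covDeriv_vel := hu.covDeriv_velocity e he

/-- The chain rule for a parametrization read in a chart. -/
theorem fderiv_chart_comp {m : ℕ} (he : e ∈ Charts M) {f : E m → M} {y : E m}
    (hf : MDifferentiableAt 𝓘(ℝ, E m) 𝓘(ℝ, E 4) f y) (hy : f y ∈ e.source) (c : E m) :
    fderiv ℝ (fun z => e (f z)) y c
      = chartDeriv e (f y) (mfderiv 𝓘(ℝ, E m) 𝓘(ℝ, E 4) f y c) := by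
  have h := mfderiv_comp y ((mdifferentiable_of_mem_charts he).mdifferentiableAt hy) hf
  rw [mfderiv_eq_fderiv] at h
  exact DFunLike.congr_fun h c

/-- Only the part of the slice inside the chart is kept. The induced metric does not mention the
chart, so the same `S.metric` serves in all of them. -/
theorem SpatialSlice.isOrthogonalSlice (S : SpatialSlice g u) (he : e ∈ Charts M) :
    IsOrthogonalSlice (g.inChart e) (vecComp u e) e.target (fun y => e (S.map y))
      (S.domain ∩ S.map ⁻¹' e.source) S.metric := by
  have hmd : ∀ y ∈ S.domain, ContMDiffAt 𝓘(ℝ, E 3) 𝓘(ℝ, E 4) ∞ S.map y := fun y hy =>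
    S.smooth.contMDiffAt (S.isOpen_domain.mem_nhds hy)
  have hs : ∀ y ∈ S.domain ∩ S.map ⁻¹' e.source, ContDiffAt ℝ ∞ (fun y => e (S.map y)) y := by
    intro y hy
    exact ((contMDiffAt_of_mem_maximalAtlas he hy.2).comp y (hmd y hy.1)).contDiffAt
  have hj : ∀ y ∈ S.domain ∩ S.map ⁻¹' e.source, ∀ c : E 3, jac (fun y => e (S.map y)) y *ᵥ c
      = (chartDeriv e (S.map y) (mfderiv 𝓘(ℝ, E 3) 𝓘(ℝ, E 4) S.map y c)).ofLp := by
    intro y hy c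
    rw [jac_mulVec (differentiableAt_of_smooth (hs y hy)),
      fderiv_chart_comp he ((hmd y hy.1).mdifferentiableAt (by simp)) hy.2]
  refine ⟨S.smooth.continuousOn.isOpen_inter_preimage S.isOpen_domain e.open_source, hs,
    fun y hy => e.map_source hy.2, ?_, ?_, ?_⟩
  · intro y hy c hc
    have h1 := hj y hy (WithLp.toLp 2 c)
    rw [hc] at h1
    have h2 : chartDeriv e (S.map y)
        (mfderiv 𝓘(ℝ, E 3) 𝓘(ℝ, E 4) S.map y (WithLp.toLp 2 c : E 3)) = 0 := by
      ext i
      exact (congrFun h1 i).symm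
    have h3 := (mdifferentiable_of_mem_charts he).mfderiv_injective hy.2
      (h2.trans (map_zero (mfderiv 𝓘(ℝ, E 4) 𝓘(ℝ, E 4) e (S.map y))).symm)
    have h4 := S.immersion y hy.1 (h3.trans (map_zero _).symm)
    exact congrArg WithLp.ofLp h4
  · intro y hy
    ext a
    have h1 := S.orthogonal y hy.1 (EuclideanSpace.single a (1 : ℝ) : E 3)
    rw [form_eq g he hy.2, ← hj y hy, dotProduct_mulVec, dotProduct_mulVec, ← vecComp_chart u hy.2,
      ← (inChart_isMetricOn g he).lower_eq_vecMul (e.map_source hy.2)] at h1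
    simpa using h1
  · intro y hy
    ext a b
    have h1 : S.metric y a b = g.form (S.map y)
        (mfderiv 𝓘(ℝ, E 3) 𝓘(ℝ, E 4) S.map y (EuclideanSpace.single a (1 : ℝ) : E 3))
        (mfderiv 𝓘(ℝ, E 3) 𝓘(ℝ, E 4) S.map y (EuclideanSpace.single b (1 : ℝ) : E 3)) := rfl
    rw [h1, form_eq g he hy.2, ← hj y hy, ← hj y hy, Matrix.dotProduct_mulVec,
      Matrix.dotProduct_mulVec, ← Matrix.vecMul_transpose, Matrix.vecMul_vecMul,
      Matrix.vecMul_vecMul]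
    simp [Matrix.mul_assoc]

/-! ### The Killing field -/

/-- The acceleration potential in a chart. -/
theorem IsAccelPotential.contDiffAt {τ : M → ℝ} (hτ : IsAccelPotential g u τ) (he : e ∈ Charts M)
    {x : E 4} (hx : x ∈ e.target) : ContDiffAt ℝ ∞ (fun y => τ (e.symm y)) x :=
  ((hτ.smooth (e.symm x)).comp x
    ((contMDiffOn_symm_of_mem_maximalAtlas he).contMDiffAt (e.open_target.mem_nhds hx))).contDiffAt

theorem pd_exp {n : ℕ} {f : E n → ℝ} {x : E n} (hf : ContDiffAt ℝ ∞ f x) (i : Fin n) :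
    pd i (fun y => Real.exp (f y)) x = Real.exp (f x) * pd i f x := by
  simp [pd, fderiv_exp (differentiableAt_of_smooth hf)]

theorem vecComp_staticKilling (u : ∀ p : M, TangentSpace 𝓘(ℝ, E 4) p) (τ : M → ℝ) (x : E 4) :
    vecComp (staticKilling u τ) e x = Real.exp (τ (e.symm x)) • vecComp u e x := by
  rw [vecComp_eq, vecComp_eq]
  exact congrArg WithLp.ofLp
    (map_smul (mfderiv 𝓘(ℝ, E 4) 𝓘(ℝ, E 4) e (e.symm x)) (Real.exp (τ (e.symm x)))
      (u (e.symm x)))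

theorem lower_staticKilling (γ : E 4 → Matrix (Fin 4) (Fin 4) ℝ)
    (u : ∀ p : M, TangentSpace 𝓘(ℝ, E 4) p) (τ : M → ℝ) (x : E 4) :
    lower γ (vecComp (staticKilling u τ) e) x
      = Real.exp (τ (e.symm x)) • lower γ (vecComp u e) x := by
  rw [lower_eq_mulVec, vecComp_staticKilling, Matrix.mulVec_smul]
  rfl

theorem isKilling_staticKilling (hu : IsStatic g u) {τ : M → ℝ} (hτ : IsAccelPotential g u τ) :
    IsKilling g (staticKilling u τ) := by
  refine ⟨fun e he i x hx => ?_, fun e he x hx i j => ?_⟩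
  · simp only [vecComp_staticKilling]
    exact (((hτ.contDiffAt he hx).exp).mul
      ((hu.isStaticOn he).smooth_vel x hx i)).contDiffWithinAt
  · have h := hu.isStaticOn he
    have key : ∀ i, covDeriv (g.inChart e) (lower (g.inChart e) (vecComp (staticKilling u τ) e)) x i
        = Real.exp (τ (e.symm x)) •
          (accel (g.inChart e) (vecComp u e) x i • lower (g.inChart e) (vecComp u e) x
            - lower (g.inChart e) (vecComp u e) x i • accel (g.inChart e) (vecComp u e) x) := by
      intro i
      have hf : lower (g.inChart e) (vecComp (staticKilling u τ) e)
          = fun y => Real.exp (τ (e.symm y)) • lower (g.inChart e) (vecComp u e) y :=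
        funext fun y => lower_staticKilling _ u τ y
      rw [covDeriv_eq, hf, pdV_smul i (hτ.contDiffAt he hx).exp
        (h.smooth_lower hx (h.smooth_vel x hx)), pd_exp (hτ.contDiffAt he hx), h.pdV_lower hx,
        ← hτ.grad e he x hx i, Matrix.smul_vecMul]
      module
    rw [key, key]
    simp only [Pi.smul_apply, Pi.sub_apply, smul_eq_mul]
    ring

/-! ### The space submanifolds -/

theorem exists_spatialSlice [IsManifold 𝓘(ℝ, E 4) ∞ M] (hu : IsStatic g u) {τ : M → ℝ} (hτ : IsAccelPotential g u τ) (p : M) :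
    ∃ S : SpatialSlice g u, ∃ y ∈ S.domain, S.map y = p := by
  set e := chartAt (E 4) p
  have he : e ∈ Charts M := IsManifold.chart_mem_maximalAtlas p
  have hp : p ∈ e.source := mem_chart_source _ p
  have h := hu.isStaticOn he
  set α : E 4 → Fin 4 → ℝ :=
    fun x => Real.exp (-τ (e.symm x)) • lower (g.inChart e) (vecComp u e) x with hα
  have hexp : ∀ x ∈ e.target, ContDiffAt ℝ ∞ (fun x => Real.exp (-τ (e.symm x))) x :=
    fun x hx => (hτ.contDiffAt he hx).neg.exp
  have hαs : ∀ x ∈ e.target, SmoothV α x := fun x hx =>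
    SmoothV.smul (hexp x hx) (h.smooth_lower hx (h.smooth_vel x hx))
  -- In ∂_i(e^{-τ} u_j) the factor e^{-τ} contributes -a_i u_j and the static condition -u_i a_j;
  -- their sum is symmetric.
  have hclosed : ∀ x ∈ e.target, ∀ i j, pd i (fun y => α y j) x = pd j (fun y => α y i) x := by
    intro x hx
    have key : ∀ i j, pd i (fun y => α y j) x = Real.exp (-τ (e.symm x)) *
        ((lower (g.inChart e) (vecComp u e) x ᵥ* conn (g.inChart e) i x) j
          - accel (g.inChart e) (vecComp u e) x i * lower (g.inChart e) (vecComp u e) x j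
          - lower (g.inChart e) (vecComp u e) x i * accel (g.inChart e) (vecComp u e) x j) := by
      intro i j
      have h1 := congrFun (pdV_smul i (hexp x hx) (h.smooth_lower hx (h.smooth_vel x hx))) j
      rw [pd_exp (hτ.contDiffAt he hx).neg, pd_neg, ← hτ.grad e he x hx i, h.pdV_lower hx] at h1
      refine h1.trans ?_
      simp only [Pi.add_apply, Pi.smul_apply, Pi.sub_apply, smul_eq_mul]
      ring
    intro i j
    have hswap : (lower (g.inChart e) (vecComp u e) x ᵥ* conn (g.inChart e) i x) j
        = (lower (g.inChart e) (vecComp u e) x ᵥ* conn (g.inChart e) j x) i := by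
      simp only [Matrix.vecMul, dotProduct, conn, Matrix.of_apply]
      exact Finset.sum_congr rfl fun k _ => by rw [h.christoffel_symm hx]
    rw [key, key, hswap]
    ring
  obtain ⟨B, f, hB, hpB, hBU, hf, hfα⟩ :=
    exists_potential e.open_target hαs hclosed (e.map_source hp)
  -- df(u) = e^{-τ} u·u = -e^{-τ} is not zero.
  have hdf : fderiv ℝ f (e p) ≠ 0 := by
    intro h0
    have h1 := hfα (e p) hpB (WithLp.toLp 2 (vecComp u e (e p)))
    have h2 : α (e p) ⬝ᵥ vecComp u e (e p) = -Real.exp (-τ (e.symm (e p))) := by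
      rw [hα, smul_dotProduct, h.unit _ (e.map_source hp)]
      simp
    rw [h0, h2] at h1
    exact Real.exp_ne_zero _ (neg_eq_zero.1 h1.symm)
  obtain ⟨D, ψ, hDo, ⟨y₀, hy₀, hy₀p⟩, hψ⟩ := exists_level_parametrization hB hf hpB hdf
  have hψU : ∀ y ∈ D, ψ y ∈ e.target := fun y hy => hBU (hψ y hy).2.1
  have hsm : ∀ y ∈ D, ContMDiffAt 𝓘(ℝ, E 3) 𝓘(ℝ, E 4) ∞ (fun z => e.symm (ψ z)) y :=
    fun y hy => (contMDiffAt_symm_of_mem_maximalAtlas he (hψU y hy)).comp y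
      (hψ y hy).1.contMDiffAt
  have hder : ∀ y ∈ D, ∀ c : E 3, fderiv ℝ ψ y c = chartDeriv e (e.symm (ψ y))
      (mfderiv 𝓘(ℝ, E 3) 𝓘(ℝ, E 4) (fun z => e.symm (ψ z)) y c) := by
    intro y hy c
    rw [← fderiv_chart_comp he ((hsm y hy).mdifferentiableAt (by simp))
      (e.map_target (hψU y hy))]
    have h1 : ψ =ᶠ[𝓝 y] fun z => e (e.symm (ψ z)) :=
      mem_of_superset (hDo.mem_nhds hy) fun z hz => (e.right_inv (hψU z hz)).symm
    rw [h1.fderiv_eq]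
  refine ⟨⟨D, fun z => e.symm (ψ z), hDo, fun y hy => (hsm y hy).contMDiffWithinAt, ?_, ?_⟩,
    y₀, hy₀, ?_⟩
  · intro y hy c d hcd
    exact (hψ y hy).2.2.1 (((hder y hy c).trans (congrArg _ hcd)).trans (hder y hy d).symm)
  · intro y hy (c : E 3)
    have hU := hψU y hy
    have h1 := (hψ y hy).2.2.2 c
    rw [hfα _ (hψ y hy).2.1] at h1
    have h2 : lower (g.inChart e) (vecComp u e) (ψ y) ⬝ᵥ (fderiv ℝ ψ y c).ofLp = 0 := by
      rw [hα, smul_dotProduct, smul_eq_mul] at h1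
      exact (mul_eq_zero.1 h1).resolve_left (Real.exp_pos _).ne'
    rw [form_eq_of_mem_target g he hU, ← hder y hy c, dotProduct_mulVec, ← vecComp_eq,
      ← h.lower_eq_vecMul hU, h2]
  · change e.symm (ψ y₀) = p
    rw [hy₀p, e.left_inv hp]

/-- The scalar curvature of a space submanifold is twice the Einstein tensor evaluated on the
velocity, in every chart. -/
theorem scalarCurv_slice (hu : IsStatic g u) (S : SpatialSlice g u) {y : E 3} (hy : y ∈ S.domain)
    (he : e ∈ Charts M) (hye : S.map y ∈ e.source) :
    scalarCurv S.metric y = spatialScalar (g.inChart e) (vecComp u e) (e (S.map y)) :=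
  (S.isOrthogonalSlice he).scalarCurv_eq (hu.isStaticOn he) ⟨hy, hye⟩

end Charts

end StaticCKG

/-! ### The global statement. -/

theorem mainTheorem2 {M : Type*} [TopologicalSpace M] [ChartedSpace (StaticCKG.E 4) M]
    [IsManifold 𝓘(ℝ, StaticCKG.E 4) ∞ M]
    (g : StaticCKG.LorentzMetric M)
    (u : ∀ p : M, TangentSpace 𝓘(ℝ, StaticCKG.E 4) p) (hu : StaticCKG.IsStatic g u)
    (τ : M → ℝ) (hτ : StaticCKG.IsAccelPotential g u τ) :
    StaticCKG.IsKilling g (StaticCKG.staticKilling u τ) ∧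
    ∃ Rstar : M → ℝ, StaticCKG.IsSpatialScalarCurv g u Rstar ∧
      ∀ e ∈ StaticCKG.Charts M, ∀ x ∈ e.target, ∀ k : Fin 4,
        ∑ l, StaticCKG.altasTekin (g.inChart e) x k l *
            StaticCKG.vecComp (StaticCKG.staticKilling u τ) e x l
          = StaticCKG.phiScalar (g.inChart e) (StaticCKG.vecComp u e) (Rstar (e.symm x)) x *
            StaticCKG.lower (g.inChart e)
              (StaticCKG.vecComp (StaticCKG.staticKilling u τ) e) x k := by
  -- R⋆ is defined as s in the preferred chart at each point.
  have hR : StaticCKG.IsSpatialScalarCurv g u fun p =>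
      StaticCKG.spatialScalar (g.inChart (chartAt (StaticCKG.E 4) p))
        (StaticCKG.vecComp u (chartAt (StaticCKG.E 4) p)) (chartAt (StaticCKG.E 4) p p) :=
    ⟨StaticCKG.exists_spatialSlice hu hτ, fun S y hy => (StaticCKG.scalarCurv_slice hu S hy
      (IsManifold.chart_mem_maximalAtlas _) (mem_chart_source _ _)).symm⟩
  refine ⟨StaticCKG.isKilling_staticKilling hu hτ, _, hR, fun e he x hx k => ?_⟩
  -- Independence of the chart follows without a transformation law: the values of s in both charts
  -- equal the scalar curvature of one slice through the point.
  obtain ⟨S, y, hy, hSy⟩ := hR.exists_slice (e.symm x)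
  have h1 := hR.eq_scalarCurv S y hy
  rw [StaticCKG.scalarCurv_slice hu S hy he (hSy ▸ e.map_target hx), hSy, e.right_inv hx] at h1
  have h2 := (hu.isStaticOn he).altasTekin_vel hx k
  rw [h1, StaticCKG.lower_staticKilling, Pi.smul_apply, smul_eq_mul, mul_left_comm, ← h2,
    Finset.mul_sum]
  refine Finset.sum_congr rfl fun l _ => ?_
  rw [StaticCKG.vecComp_staticKilling, Pi.smul_apply, smul_eq_mul, mul_left_comm]
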